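/- Let $\mathbf k=\mathbb R$ or $\mathbb C$, and work with finite-dimensional smooth (resp. complex) manifolds and smooth (resp. holomorphic) tensor fields and maps. Let $\mathfrak g$ be a finite-dimensional Lie algebra over $\mathbf k$, and let $r=\sum_i x_i\otimes y_i\in\mathfrak g\otimes\mathfrak g$ be a quasitriangular $r$-matrix: its symmetric part $s$ is $\mathrm{ad}$-invariant and $\mathrm{CYB}(r)=[r_{12},r_{13}]+[r_{12},r_{23}]+[r_{13},r_{23}]=0$. Write $r=\Lambda+s$ with $\Lambda$ skew-symmetric, $r^{21}=\sum_i y_i\otimes x_i$, $\delta_r(x)=\mathrm{ad}_x r$, and $\phi_s=-2\,\mathrm{CYB}(s)$. We use $a\wedge b=a\otimes b-b\otimes a$. A left action of a Lie algebra on a manifold $Y$ is a Lie algebra anti-homomorphism $\lambda$ to the vector fields on $Y$, extended to tensors by $\lambda(x\otimes y)=\lambda(x)\otimes\lambda(y)$, and similarly for $3$-tensors. For a Lie bialgebra $(\mathfrak h,\delta)$, let $\mathcal P(\mathfrak h,\delta)$ be the category of left $(\mathfrak h,\delta)$-Poisson spaces: triples $(Y,\pi,\lambda)$ with $\lambda$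 a left action of $\mathfrak h$ on $Y$ and $\pi$ a bivector field such that $[\pi,\pi]=0$ and $[\lambda(x),\pi]=\lambda(\delta(x))$ for $x\in\mathfrak h$. For $\phi\in(\wedge^3\mathfrak h)^{\mathfrak h}$, let $\mathcal{QP}(\mathfrak h,\phi)$ be the category of $(\mathfrak h,\phi)$-quasi-Poisson spaces: triples $(Y,Q,\lambda)$ with $\lambda$ a left action and $Q$ an $\mathfrak h$-invariant bivector field with $[Q,Q]=\lambda(\phi)$. Brackets of multivector fields are Schouten brackets, and morphisms are the equivariant maps that respect the bivector fields. Let $n\ge 2$. For a tensor $X$ on $\mathfrak g$ let $(X)_j$ be its image under the $j$-th inclusion $\mathfrak g\to\mathfrak g^n$. Put $\mathrm{Mix}^n(r)=\sum_{1\le j<k\le n}\sum_i (y_i)_j\wedge(x_i)_k$ (and define $\mathrm{Mix}^n(s)$ in the same way from $s$), $\mathrm{Alt}^n(r)=(r,-r^{21},r,-r^{21},\dots)=\sum_{j\text{ odd}}(r)_j-\sum_{j\text{ even}}(r^{21})_j$, $r^{(n)}=\mathrm{Alt}^n(r)-\mathrm{Mix}^n(r)\in\mathfrak g^n\otimes\mathfrak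 g^n$, $\phi_s^n=\sum_j(\phi_s)_j$, and $\mathrm{diag}(x)=(x,\dots,x)$. Then $r^{(n)}$ is a quasitriangular $r$-matrix on $\mathfrak g^n$ with skew-symmetric part $(\Lambda,\dots,\Lambda)-\mathrm{Mix}^n(r)$, and $\phi_{s'}=\phi_s^n$ for its symmetric part $s'$. The following are well-defined functors; each is the identity on underlying manifolds and maps, and the first two are equivalences of categories, with inverse given by subtracting the same term: $$T:\mathcal P(\mathfrak g,\delta_r)\to\mathcal{QP}(\mathfrak g,\phi_s),\quad (Y,\pi,\lambda)\mapsto(Y,\pi+\lambda(\Lambda),\lambda),$$ $$T_n:\mathcal P(\mathfrak g^n,\delta_{r^{(n)}})\to\mathcal{QP}(\mathfrak g^n,\phi_s^n),\quad (Y,\pi,\lambda)\mapsto\bigl(Y,\pi+\lambda(\Lambda,\dots,\Lambda)-\lambda(\mathrm{Mix}^n(r)),\lambda\bigr),$$ $$\mathrm{Res}:\mathcal P(\mathfrak g^n,\delta_{r^{(n)}})\to\mathcal P(\mathfrak g,\delta_r),\quad (Y,\pi,\lambda)\mapsto(Y,\pi,\lambda\circ\mathrm{diag}),$$ $$\mathrm{Fus}:\mathcal{QP}(\mathfrak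 g^n,\phi_s^n)\to\mathcal{QP}(\mathfrak g,\phi_s),\quad (Y,Q,\lambda)\mapsto(Y,Q+\lambda(\mathrm{Mix}^n(s)),\lambda\circ\mathrm{diag}).$$ They satisfy $T\circ\mathrm{Res}=\mathrm{Fus}\circ T_n$ and $\mathrm{Res}\circ T_n^{-1}=T^{-1}\circ\mathrm{Fus}$. Consequently, let $(Y_j,\pi_j,\lambda_j)\in\mathcal P(\mathfrak g,\delta_r)$ for $1\le j\le n$, put $Y=Y_1\times\cdots\times Y_n$, let $\lambda=(\lambda_1,\dots,\lambda_n)$ be the product action of $\mathfrak g^n$ on $Y$, and let $(Y_j,Q_j,\lambda_j)=T(Y_j,\pi_j,\lambda_j)$. Then the fusion product $\bigl(Y,(\pi_1,\dots,\pi_n)+\lambda(\mathrm{Mix}^n(r)),\lambda\circ\mathrm{diag}\bigr)$ lies in $\mathcal P(\mathfrak g,\delta_r)$, the fusion product $\bigl(Y,(Q_1,\dots,Q_n)+\lambda(\mathrm{Mix}^n(s)),\lambda\circ\mathrm{diag}\bigr)$ lies in $\mathcal{QP}(\mathfrak g,\phi_s)$, and $T$ sends the first to the second. -/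

import Mathlib

open scoped Manifold ContDiff TensorProduct
open CategoryTheory

universe w v u

namespace QuasiPoisson

noncomputable section

/-! ### Tensors on a Lie algebra -/

section Algebra

variable {𝕜 : Type*} [RCLike 𝕜] {V : Type*} [AddCommGroup V] [Module 𝕜 V]
variable {L : Type*} [LieRing L] [LieAlgebra 𝕜 L]

/-- The flip `r ↦ r²¹`, `x ⊗ y ↦ y ⊗ x`. -/
def flip (r : V ⊗[𝕜] V) : V ⊗[𝕜] V := TensorProduct.comm 𝕜 V V r

/-- The symmetric part of a 2-tensor. -/
def symPart (r : V ⊗[𝕜] V) : V ⊗[𝕜] V := (2⁻¹ : 𝕜) • (r + flip r)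

/-- The skew-symmetric part of a 2-tensor. -/
def skewPart (r : V ⊗[𝕜] V) : V ⊗[𝕜] V := (2⁻¹ : 𝕜) • (r - flip r)

/-- The Lie bracket as a bilinear map. -/
def lieBilin : L →ₗ[𝕜] L →ₗ[𝕜] L :=
  LinearMap.mk₂ 𝕜 (fun x y => ⁅x, y⁆) add_lie smul_lie lie_add (fun c x y => lie_smul c x y)

/-- The bilinear operation
`(a ⊗ b, c ⊗ d) ↦ [a, c] ⊗ b ⊗ d + a ⊗ [b, c] ⊗ d + a ⊗ c ⊗ [b, d]`,
that is `(q, q') ↦ [q₁₂, q'₁₃] + [q₁₂, q'₂₃] + [q₁₃, q'₂₃]`. -/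
def cybBilin : L ⊗[𝕜] L →ₗ[𝕜] L ⊗[𝕜] L →ₗ[𝕜] L ⊗[𝕜] (L ⊗[𝕜] L) :=
  TensorProduct.map₂ lieBilin (TensorProduct.mk 𝕜 L L)
  + TensorProduct.lift (LinearMap.mk₂ 𝕜
      (fun a b : L => TensorProduct.mk 𝕜 L (L ⊗[𝕜] L) a ∘ₗ LinearMap.rTensor L (lieBilin b))
      (by intros; ext; simp)
      (by intros; ext; simp)
      (by intros; ext; simp [TensorProduct.tmul_add])
      (by intros; ext; simp))
  + (TensorProduct.map₂ (TensorProduct.mk 𝕜 L L) lieBilin).compr₂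
      (TensorProduct.assoc 𝕜 L L L).toLinearMap

theorem cybBilin_tmul (a b c d : L) :
    cybBilin (𝕜 := 𝕜) (a ⊗ₜ b) (c ⊗ₜ d) =
      ⁅a, c⁆ ⊗ₜ (b ⊗ₜ d) + a ⊗ₜ (⁅b, c⁆ ⊗ₜ d) + a ⊗ₜ (c ⊗ₜ ⁅b, d⁆) := by
  simp [cybBilin, lieBilin]

/-- The classical Yang-Baxter operator `CYB(r) = [r₁₂, r₁₃] + [r₁₂, r₂₃] + [r₁₃, r₂₃]`. -/
def cyb (r : L ⊗[𝕜] L) : L ⊗[𝕜] (L ⊗[𝕜] L) := cybBilin r r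

/-- Quasitriangular `r`-matrices: the symmetric part is `ad`-invariant and `CYB(r) = 0`. -/
def IsQuasitriangular (r : L ⊗[𝕜] L) : Prop :=
  (∀ x : L, ⁅x, symPart r⁆ = 0) ∧ cyb r = 0

/-- The co-bracket `δ_r(x) = ad_x r`. -/
def coBracket (r : L ⊗[𝕜] L) : L →ₗ[𝕜] L ⊗[𝕜] L :=
  { toFun := fun x => ⁅x, r⁆
    map_add' := fun x y => add_lie x y r
    map_smul' := fun c x => smul_lie c x r }

/-- The invariant trivector `φ_s = -2 CYB(s)`. -/
def phi (s : L ⊗[𝕜] L) : L ⊗[𝕜] (L ⊗[𝕜] L) := (-2 : 𝕜) • cyb s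

/-- Functoriality of triple tensors. -/
def map₃ {W : Type*} [AddCommGroup W] [Module 𝕜 W] (f : V →ₗ[𝕜] W) :
    V ⊗[𝕜] (V ⊗[𝕜] V) →ₗ[𝕜] W ⊗[𝕜] (W ⊗[𝕜] W) :=
  TensorProduct.map f (TensorProduct.map f f)

/-- The value of a 2-tensor on two covectors, `(v ⊗ w)(α, β) = α(v) β(w)`. -/
def pair₂ (t : V ⊗[𝕜] V) (α β : V →ₗ[𝕜] 𝕜) : 𝕜 :=
  LinearMap.mul' 𝕜 𝕜 (TensorProduct.map α β t)

/-- The value of a 3-tensor on three covectors. -/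
def pair₃ (t : V ⊗[𝕜] (V ⊗[𝕜] V)) (α β γ : V →ₗ[𝕜] 𝕜) : 𝕜 :=
  LinearMap.mul' 𝕜 𝕜
    (TensorProduct.map α (LinearMap.mul' 𝕜 𝕜 ∘ₗ TensorProduct.map β γ) t)

/-! ### The direct product Lie algebra `L^n` and its tensors -/

instance piLieRing {n : ℕ} : LieRing (Fin n → L) where
  bracket x y := fun j => ⁅x j, y j⁆
  add_lie x y z := funext fun j => add_lie (x j) (y j) (z j)
  lie_add x y z := funext fun j => lie_add (x j) (y j) (z j)
  lie_self x := funext fun j => lie_self (x j)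
  leibniz_lie x y z := funext fun j => leibniz_lie (x j) (y j) (z j)

instance piLieAlgebra {n : ℕ} : LieAlgebra 𝕜 (Fin n → L) where
  lie_smul c x y := funext fun j => lie_smul c (x j) (y j)

variable (n : ℕ)

/-- The embedding of `V` into `V^n` as the `j`-th summand. -/
def incl (𝕜 : Type*) [RCLike 𝕜] (V : Type*) [AddCommGroup V] [Module 𝕜 V] {n : ℕ} (j : Fin n) :
    V →ₗ[𝕜] (Fin n → V) :=
  LinearMap.single 𝕜 (fun _ : Fin n => V) j

/-- The diagonal `x ↦ (x, …, x)`. -/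
def diag (𝕜 : Type*) [RCLike 𝕜] (V : Type*) [AddCommGroup V] [Module 𝕜 V] (n : ℕ) :
    V →ₗ[𝕜] (Fin n → V) :=
  LinearMap.pi fun _ => LinearMap.id

/-- `(t, t, …, t)` for a 2-tensor `t`. -/
def copies₂ (t : V ⊗[𝕜] V) : (Fin n → V) ⊗[𝕜] (Fin n → V) :=
  ∑ j : Fin n, TensorProduct.map (incl 𝕜 V j) (incl 𝕜 V j) t

/-- `(φ, φ, …, φ)` for a 3-tensor `φ`. -/
def copies₃ (t : V ⊗[𝕜] (V ⊗[𝕜] V)) :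
    (Fin n → V) ⊗[𝕜] ((Fin n → V) ⊗[𝕜] (Fin n → V)) :=
  ∑ j : Fin n, map₃ (incl 𝕜 V j) t

/-- `Altⁿ(r) = (r, -r²¹, r, -r²¹, …)`. -/
def alt (r : V ⊗[𝕜] V) : (Fin n → V) ⊗[𝕜] (Fin n → V) :=
  ∑ j : Fin n, TensorProduct.map (incl 𝕜 V j) (incl 𝕜 V j)
    (if Even (j : ℕ) then r else -flip r)

/-- `Mixⁿ(r) = ∑_{j < k} ∑_i (y_i)_j ∧ (x_i)_k` for `r = ∑_i x_i ⊗ y_i`,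
where `a ∧ b = a ⊗ b - b ⊗ a`. -/
def mix (r : V ⊗[𝕜] V) : (Fin n → V) ⊗[𝕜] (Fin n → V) :=
  ∑ j : Fin n, ∑ k : Fin n, if j < k then
    TensorProduct.map (incl 𝕜 V j) (incl 𝕜 V k) (flip r)
      - TensorProduct.map (incl 𝕜 V k) (incl 𝕜 V j) r
  else 0

/-- `r^{(n)} = Altⁿ(r) - Mixⁿ(r)`. -/
def rPow (r : V ⊗[𝕜] V) : (Fin n → V) ⊗[𝕜] (Fin n → V) := alt n r - mix n r

end Algebra

/-! ### Manifolds, 2-tensor fields, Schouten brackets -/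

/-- Finite dimensional manifolds over `𝕜`: smooth manifolds for `𝕜 = ℝ`, complex manifolds for
`𝕜 = ℂ` (maps between complex spaces that are `C^∞` over `ℂ` are the holomorphic ones). -/
structure Mfd (𝕜 : Type w) [RCLike 𝕜] where
  E : Type u
  carrier : Type u
  [normedE : NormedAddCommGroup E]
  [spaceE : NormedSpace 𝕜 E]
  [finE : FiniteDimensional 𝕜 E]
  [top : TopologicalSpace carrier]
  [t2 : T2Space carrier]
  [sc : SecondCountableTopology carrier]
  [charted : ChartedSpace E carrier]
  [mfd : IsManifold 𝓘(𝕜, E) ∞ carrier]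

attribute [instance] Mfd.normedE Mfd.spaceE Mfd.finE Mfd.top Mfd.t2 Mfd.sc Mfd.charted Mfd.mfd

section Manifold

variable {𝕜 : Type w} [RCLike 𝕜]

/-- The tangent space. -/
abbrev Mfd.T (M : Mfd.{w, u} 𝕜) (y : M.carrier) : Type u := TangentSpace 𝓘(𝕜, M.E) y

/-- Not necessarily continuous sections of `TM`. -/
abbrev Mfd.VField (M : Mfd.{w, u} 𝕜) : Type u := ∀ y : M.carrier, M.T y

/-- Not necessarily continuous sections of `TM ⊗ TM`. -/
abbrev Mfd.TField (M : Mfd.{w, u} 𝕜) : Type u := ∀ y : M.carrier, M.T y ⊗[𝕜] M.T y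

variable (M : Mfd.{w, u} 𝕜)

/-- The differential of a function at a point. -/
def Mfd.d (f : M.carrier → 𝕜) (y : M.carrier) : M.T y →ₗ[𝕜] 𝕜 :=
  (mvfderiv 𝓘(𝕜, M.E) f y : M.T y →L[𝕜] 𝕜)

/-- A function defined near `y` and smooth (holomorphic) at `y`. -/
def Mfd.SmoothAt (f : M.carrier → 𝕜) (y : M.carrier) : Prop :=
  ContMDiffAt 𝓘(𝕜, M.E) 𝓘(𝕜, 𝕜) ∞ f y

/-- The function `X(f)`. -/
def Mfd.deriv (X : M.VField) (f : M.carrier → 𝕜) : M.carrier → 𝕜 :=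
  fun y => M.d f y (X y)

/-- The function `A(df, dg)`. -/
def Mfd.eval (A : M.TField) (f g : M.carrier → 𝕜) : M.carrier → 𝕜 :=
  fun y => pair₂ (A y) (M.d f y) (M.d g y)

/-- Smooth (holomorphic) vector fields. -/
def Mfd.IsSmoothVField (X : M.VField) : Prop :=
  ContMDiff 𝓘(𝕜, M.E) 𝓘(𝕜, M.E).tangent ∞
    (fun y => (⟨y, X y⟩ : TangentBundle 𝓘(𝕜, M.E) M.carrier))

/-- Smooth (holomorphic) bi-vector fields: skew-symmetric sections `A` of `TM ⊗ TM` such that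
`A(df, dg)` is smooth wherever `f` and `g` are. -/
def Mfd.IsBivector (A : M.TField) : Prop :=
  (∀ y, flip (A y) = -A y) ∧
  ∀ (y : M.carrier) (f g : M.carrier → 𝕜), M.SmoothAt f y → M.SmoothAt g y →
    M.SmoothAt (M.eval A f g) y

/-- The Schouten bracket `[X, B]` of a vector field and a bi-vector field (the Lie derivative of
`B` along `X`), evaluated on `df, dg`. -/
def Mfd.lieD (X : M.VField) (B : M.TField) (f g : M.carrier → 𝕜) : M.carrier → 𝕜 :=
  M.deriv X (M.eval B f g) - M.eval B (M.deriv X f) g - M.eval B f (M.deriv X g)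

/-- The Schouten bracket `[A, B]` of two bi-vector fields, evaluated on `df, dg, dh`: the sum of
`A(f, B(g, h)) + B(f, A(g, h))` over the cyclic permutations of `(f, g, h)`. The sign is the one for
which `[X, B ∧ C] = [X, B] ∧ C + B ∧ [X, C]` for vector fields `X`, and
`[X ∧ Y, X ∧ Y] = 2 [X, Y] ∧ X ∧ Y`. -/
def Mfd.schouten (A B : M.TField) (f g h : M.carrier → 𝕜) : M.carrier → 𝕜 :=
  (M.eval A f (M.eval B g h) + M.eval B f (M.eval A g h))
  + (M.eval A g (M.eval B h f) + M.eval B g (M.eval A h f))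
  + (M.eval A h (M.eval B f g) + M.eval B h (M.eval A f g))

/-- The product manifold `M₁ × ⋯ × M_n`. -/
def Mfd.pi {n : ℕ} (M : Fin n → Mfd.{w, u} 𝕜) : Mfd.{w, u} 𝕜 where
  E := ∀ i, (M i).E
  carrier := ∀ i, (M i).carrier
  charted := piChartedSpace (fun i => (M i).E) (fun i => (M i).carrier)
  mfd := by
    let _ : ChartedSpace (∀ i, (M i).E) (∀ i, (M i).carrier) :=
      piChartedSpace (fun i => (M i).E) (fun i => (M i).carrier)
    apply isManifold_of_contDiffOn
    rintro _ _ ⟨e, he, rfl⟩ ⟨e', he', rfl⟩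
    rw [contDiffOn_pi]
    intro i
    have h : ContDiffOn 𝕜 ∞ ((e i).symm ≫ₕ e' i) ((e i).symm ≫ₕ e' i).source := by
      have h' := contMDiffOn_of_mem_contDiffGroupoid
        ((contDiffGroupoid ∞ 𝓘(𝕜, (M i).E)).compatible (he i trivial) (he' i trivial))
      exact h'.contDiffOn
    have h2 := h.comp (s := (fun x : ∀ i, (M i).E => x i) ⁻¹' ((e i).symm ≫ₕ e' i).source)
      (ContinuousLinearMap.proj (R := 𝕜) (φ := fun i => (M i).E) i).contDiff.contDiffOn (fun x hx => hx)
    refine h2.mono ?_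
    rintro x ⟨hx, -⟩
    simp only [OpenPartialHomeomorph.trans_source, OpenPartialHomeomorph.symm_source,
      modelWithCornersSelf_coe_symm, Set.preimage_id_eq, id, OpenPartialHomeomorph.pi,
      Set.mem_inter_iff, Set.mem_preimage] at hx
    exact ⟨hx.1 i trivial, hx.2 i trivial⟩

end Manifold

/-! ### Spaces with an action and a 2-tensor field -/

section Spaces

variable {𝕜 : Type w} [RCLike 𝕜] {L : Type v} [LieRing L] [LieAlgebra 𝕜 L]

/-- A manifold `Y` with a 2-tensor field and a linear map from `L` to vector fields, before any
condition is imposed. The conditions are in `IsPoissonSpace` and `IsQuasiPoissonSpace`. -/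
structure PreSpace (𝕜 : Type w) [RCLike 𝕜] (L : Type v) [LieRing L] [LieAlgebra 𝕜 L] where
  M : Mfd.{w, u} 𝕜
  tensor : M.TField
  act : L →ₗ[𝕜] M.VField

namespace PreSpace

/-- The map `x ↦ λ(x)(y)` from `L` to `T_y Y`. -/
def actAt (Y : PreSpace.{w, v, u} 𝕜 L) (y : Y.M.carrier) : L →ₗ[𝕜] Y.M.T y :=
  LinearMap.proj y ∘ₗ Y.act

/-- The 2-tensor field `λ(t)`, for `t ∈ L ⊗ L`. -/
def act₂ (Y : PreSpace.{w, v, u} 𝕜 L) (t : L ⊗[𝕜] L) : Y.M.TField :=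
  fun y => TensorProduct.map (Y.actAt y) (Y.actAt y) t

/-- `λ` is a left Lie algebra action: a Lie algebra anti-homomorphism from `L` to the smooth
(holomorphic) vector fields on `Y`. -/
def IsLeftAction (Y : PreSpace.{w, v, u} 𝕜 L) : Prop :=
  (∀ x, Y.M.IsSmoothVField (Y.act x)) ∧
  ∀ x x' : L, Y.act ⁅x, x'⁆ = -VectorField.mlieBracket 𝓘(𝕜, Y.M.E) (Y.act x) (Y.act x')

/-- Left `(L, δ)`-Poisson spaces `(Y, π, λ)`: `π` is a Poisson bi-vector field, `λ` is a left
action, and `[λ(x), π] = λ(δ(x))` for `x ∈ L`. -/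
structure IsPoissonSpace (δ : L →ₗ[𝕜] L ⊗[𝕜] L) (Y : PreSpace.{w, v, u} 𝕜 L) : Prop where
  isLeftAction : Y.IsLeftAction
  isBivector : Y.M.IsBivector Y.tensor
  poisson : ∀ (y : Y.M.carrier) (f g h : Y.M.carrier → 𝕜),
    Y.M.SmoothAt f y → Y.M.SmoothAt g y → Y.M.SmoothAt h y →
    Y.M.schouten Y.tensor Y.tensor f g h y = 0
  poissonAction : ∀ (x : L) (y : Y.M.carrier) (f g : Y.M.carrier → 𝕜),
    Y.M.SmoothAt f y → Y.M.SmoothAt g y →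
    Y.M.lieD (Y.act x) Y.tensor f g y = Y.M.eval (Y.act₂ (δ x)) f g y

/-- `(L, φ)`-quasi-Poisson spaces `(Y, Q, λ)`: `λ` is a left action, `Q` is an `L`-invariant
bi-vector field, and `[Q, Q] = λ(φ)`. -/
structure IsQuasiPoissonSpace (φ : L ⊗[𝕜] (L ⊗[𝕜] L)) (Y : PreSpace.{w, v, u} 𝕜 L) : Prop where
  isLeftAction : Y.IsLeftAction
  isBivector : Y.M.IsBivector Y.tensor
  invariant : ∀ (x : L) (y : Y.M.carrier) (f g : Y.M.carrier → 𝕜),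
    Y.M.SmoothAt f y → Y.M.SmoothAt g y → Y.M.lieD (Y.act x) Y.tensor f g y = 0
  quasiPoisson : ∀ (y : Y.M.carrier) (f g h : Y.M.carrier → 𝕜),
    Y.M.SmoothAt f y → Y.M.SmoothAt g y → Y.M.SmoothAt h y →
    Y.M.schouten Y.tensor Y.tensor f g h y =
      pair₃ (map₃ (Y.actAt y) φ) (Y.M.d f y) (Y.M.d g y) (Y.M.d h y)

/-- Morphisms: smooth (holomorphic) `L`-equivariant maps that send one 2-tensor field to the
other. -/
@[ext]
structure Hom (Y Z : PreSpace.{w, v, u} 𝕜 L) where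
  toFun : Y.M.carrier → Z.M.carrier
  smooth : ContMDiff 𝓘(𝕜, Y.M.E) 𝓘(𝕜, Z.M.E) ∞ toFun
  map_tensor : ∀ y : Y.M.carrier,
    TensorProduct.map
      (mfderiv 𝓘(𝕜, Y.M.E) 𝓘(𝕜, Z.M.E) toFun y : Y.M.T y →L[𝕜] Z.M.T (toFun y)).toLinearMap
      (mfderiv 𝓘(𝕜, Y.M.E) 𝓘(𝕜, Z.M.E) toFun y : Y.M.T y →L[𝕜] Z.M.T (toFun y)).toLinearMap
      (Y.tensor y) = Z.tensor (toFun y)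
  map_act : ∀ (x : L) (y : Y.M.carrier),
    mfderiv 𝓘(𝕜, Y.M.E) 𝓘(𝕜, Z.M.E) toFun y (Y.act x y) = Z.act x (toFun y)

instance : Category (PreSpace.{w, v, u} 𝕜 L) where
  Hom := Hom
  id Y :=
    { toFun := id
      smooth := contMDiff_id
      map_tensor := fun y => by
        rw [mfderiv_id]
        exact LinearMap.congr_fun TensorProduct.map_id (Y.tensor y)
      map_act := fun x y => by rw [mfderiv_id]; rfl }
  comp {X Y Z} F G :=
    { toFun := G.toFun ∘ F.toFun
      smooth := G.smooth.comp F.smooth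
      map_tensor := fun y => by
        rw [mfderiv_comp y (G.smooth.mdifferentiable (by simp) _)
          (F.smooth.mdifferentiable (by simp) _), Function.comp_apply, ← G.map_tensor,
          ← F.map_tensor, ← LinearMap.comp_apply, ← TensorProduct.map_comp]
        rfl
      map_act := fun x y => by
        rw [mfderiv_comp y (G.smooth.mdifferentiable (by simp) _)
          (F.smooth.mdifferentiable (by simp) _), Function.comp_apply, ← G.map_act,
          ← F.map_act]
        rfl }

/-- Twisting by `t ∈ L ⊗ L`: `(Y, A, λ) ↦ (Y, A + λ(t), λ)`, identity on morphisms. -/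
def twist (t : L ⊗[𝕜] L) : PreSpace.{w, v, u} 𝕜 L ⥤ PreSpace.{w, v, u} 𝕜 L where
  obj Y := { M := Y.M, tensor := Y.tensor + Y.act₂ t, act := Y.act }
  map {Y Z} F :=
    { toFun := F.toFun
      smooth := F.smooth
      map_tensor := fun y => by
        have h : (mfderiv 𝓘(𝕜, Y.M.E) 𝓘(𝕜, Z.M.E) F.toFun y :
            Y.M.T y →L[𝕜] Z.M.T (F.toFun y)).toLinearMap ∘ₗ Y.actAt y
              = Z.actAt (F.toFun y) := by
          ext x; exact F.map_act x y
        simp only [Pi.add_apply, map_add]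
        rw [F.map_tensor, act₂, act₂, ← LinearMap.comp_apply, ← TensorProduct.map_comp, h]
      map_act := F.map_act }

/-- Restriction of the action along a linear map `φ`: `(Y, A, λ) ↦ (Y, A, λ ∘ φ)`, identity on
morphisms. -/
def restrict {L' : Type v} [LieRing L'] [LieAlgebra 𝕜 L'] (φ : L' →ₗ[𝕜] L) :
    PreSpace.{w, v, u} 𝕜 L ⥤ PreSpace.{w, v, u} 𝕜 L' where
  obj Y := { M := Y.M, tensor := Y.tensor, act := Y.act ∘ₗ φ }
  map F :=
    { toFun := F.toFun
      smooth := F.smooth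
      map_tensor := F.map_tensor
      map_act := fun x y => F.map_act (φ x) y }

/-- The direct product `(Y₁ × ⋯ × Y_n, (A₁, …, A_n), (λ₁, …, λ_n))`, with action of `L^n`. -/
def prod {n : ℕ} (Y : Fin n → PreSpace.{w, v, u} 𝕜 L) : PreSpace.{w, v, u} 𝕜 (Fin n → L) where
  M := Mfd.pi fun j => (Y j).M
  tensor := fun y => ∑ j : Fin n,
    TensorProduct.map (LinearMap.single 𝕜 (fun j => (Y j).M.E) j)
      (LinearMap.single 𝕜 (fun j => (Y j).M.E) j) ((Y j).tensor (y j))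
  act :=
    { toFun := fun x y j => (Y j).act (x j) (y j)
      map_add' := fun x x' => by
        funext y j
        exact congrFun ((Y j).act.map_add (x j) (x' j)) (y j)
      map_smul' := fun c x => by
        funext y j
        exact congrFun ((Y j).act.map_smul c (x j)) (y j) }

/-- The fusion product with mixing term `m ∈ L^n ⊗ L^n`:
`(Y₁ × ⋯ × Y_n, (A₁, …, A_n) + λ(m), λ_diag)`. -/
def fusion {n : ℕ} (m : (Fin n → L) ⊗[𝕜] (Fin n → L)) (Y : Fin n → PreSpace.{w, v, u} 𝕜 L) :
    PreSpace.{w, v, u} 𝕜 L :=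
  (restrict (diag 𝕜 L n)).obj ((twist m).obj (prod Y))

end PreSpace

/-- The category of left `(L, δ)`-Poisson spaces. -/
abbrev PoissonCat (δ : L →ₗ[𝕜] L ⊗[𝕜] L) : Type (max (u + 1) v w) :=
  ObjectProperty.FullSubcategory (PreSpace.IsPoissonSpace.{w, v, u} δ)

/-- The category of `(L, φ)`-quasi-Poisson spaces. -/
abbrev QuasiPoissonCat (φ : L ⊗[𝕜] (L ⊗[𝕜] L)) : Type (max (u + 1) v w) :=
  ObjectProperty.FullSubcategory (PreSpace.IsQuasiPoissonSpace.{w, v, u} φ)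

/-- The functor `PoissonCat → PreSpace` that forgets the conditions on a space. -/
abbrev PoissonCat.incl (δ : L →ₗ[𝕜] L ⊗[𝕜] L) :
    PoissonCat.{w, v, u} δ ⥤ PreSpace.{w, v, u} 𝕜 L :=
  ObjectProperty.ι (PreSpace.IsPoissonSpace.{w, v, u} δ)

/-- The functor `QuasiPoissonCat → PreSpace` that forgets the conditions on a space. -/
abbrev QuasiPoissonCat.incl (φ : L ⊗[𝕜] (L ⊗[𝕜] L)) :
    QuasiPoissonCat.{w, v, u} φ ⥤ PreSpace.{w, v, u} 𝕜 L :=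
  ObjectProperty.ι (PreSpace.IsQuasiPoissonSpace.{w, v, u} φ)

end Spaces

end

end QuasiPoisson

/-! There is one twisting theorem, one algebraic identity, and the remark that everything else is a
composite of the two.

Twisting. Since `s` is invariant, `ad_x Λ = ad_x r`, and an anti-homomorphism gives `[λ(x), λ(Λ)] =
-λ(ad_x Λ)`. So adding `λ(Λ)` to `π` turns the Poisson action condition into invariance. For the
Schouten square, let `C` be the cyclic sum of `∑ a ⊗ ad_b Λ`, where `Λ = ∑ a ⊗ b`. Then `[π, λ(Λ)] =
λ(C)` and `[λ(Λ), λ(Λ)] = -λ(C)`, while `C = 2 CYB(Λ) = -2 CYB(s) = φ_s`. Hence `[Q, Q] = 2λ(C) -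
λ(C) = λ(φ_s)`, and the converse is the same computation with `-Λ` (`IsPoissonSpace.twist`,
`IsQuasiPoissonSpace.twist`, resting on `IsLeftAction.schouten_act₂`, `cyclic_lTensor_coBracket` and
`IsQuasitriangular.two_smul_cyb_skewPart`).

Algebra on `L^n`. In block form every entry of `r^{(n)}` is `r` or `-r²¹`: the first below the
diagonal, the second above, alternating on it. The two differ by the invariant tensor `2s`.
Therefore `CYB(r^{(n)})` splits into mixed Yang-Baxter expressions in `r` and `-r²¹`, all of which
vanish for the sign patterns that occur (`IsQuasitriangular.mixedCyb_eq_zero`, `cyb_block`), and the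
diagonal respects the co-brackets (`coBracket_rPow_diag`), which makes `Res` well defined. The
symmetric part is `(s, -s, s, …)`, so `φ` is `(φ_s, …, φ_s)`.

The square commutes because of `diag(Λ) = (Λ, …, Λ) - Mixⁿ(r) + Mixⁿ(s)` (`map_diag_skewPart_eq`).
The same identity gives `Fus = T ∘ Res ∘ T_n⁻¹` on underlying data, so `Fus` lands in quasi-Poisson
spaces without any further Schouten computation.

Fusion products. A plain product of quasi-Poisson spaces is quasi-Poisson for `L^n`
(`IsQuasiPoissonSpace.prod`). Applying `Fus` to the product of the `T(Y_j)` gives one fusion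
product; applying `Res ∘ T_n⁻¹` gives the other, since the terms `(Λ, …, Λ)` cancel and leave
`+Mixⁿ(r)`.

The brackets are defined by their values on differentials of functions, so the analysis consists in
proving that these values depend only on the differentials at the point. This comes from the fact
that a commutator of derivations is a vector field (`Mfd.d_mlieBracket`). -/

namespace QuasiPoisson

noncomputable section

/-! ### Tensors evaluated on covectors -/

section Pairings

variable {𝕜 : Type*} [RCLike 𝕜] {V W : Type*} [AddCommGroup V] [Module 𝕜 V]
  [AddCommGroup W] [Module 𝕜 W]

@[simp] theorem pair₂_tmul (a b : V) (α β : V →ₗ[𝕜] 𝕜) :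
    pair₂ (a ⊗ₜ[𝕜] b) α β = α a * β b := by simp [pair₂]

@[simp] theorem pair₃_tmul (a b c : V) (α β γ : V →ₗ[𝕜] 𝕜) :
    pair₃ (a ⊗ₜ[𝕜] (b ⊗ₜ[𝕜] c)) α β γ = α a * (β b * γ c) := by simp [pair₃]

@[simp] theorem pair₂_zero (α β : V →ₗ[𝕜] 𝕜) : pair₂ 0 α β = 0 := by simp [pair₂]

@[simp] theorem pair₂_add (t t' : V ⊗[𝕜] V) (α β : V →ₗ[𝕜] 𝕜) :
    pair₂ (t + t') α β = pair₂ t α β + pair₂ t' α β := by simp [pair₂]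

@[simp] theorem pair₂_neg (t : V ⊗[𝕜] V) (α β : V →ₗ[𝕜] 𝕜) :
    pair₂ (-t) α β = -pair₂ t α β := by simp [pair₂]

@[simp] theorem pair₃_zero (α β γ : V →ₗ[𝕜] 𝕜) : pair₃ 0 α β γ = 0 := by simp [pair₃]

@[simp] theorem pair₃_add (t t' : V ⊗[𝕜] (V ⊗[𝕜] V)) (α β γ : V →ₗ[𝕜] 𝕜) :
    pair₃ (t + t') α β γ = pair₃ t α β γ + pair₃ t' α β γ := by simp [pair₃]

@[simp] theorem pair₃_neg (t : V ⊗[𝕜] (V ⊗[𝕜] V)) (α β γ : V →ₗ[𝕜] 𝕜) :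
    pair₃ (-t) α β γ = -pair₃ t α β γ := by simp [pair₃]

theorem pair₃_smul (c : 𝕜) (t : V ⊗[𝕜] (V ⊗[𝕜] V)) (α β γ : V →ₗ[𝕜] 𝕜) :
    pair₃ (c • t) α β γ = c * pair₃ t α β γ := by simp [pair₃]

theorem pair₂_sum {ι : Type*} (s : Finset ι) (t : ι → V ⊗[𝕜] V) (α β : V →ₗ[𝕜] 𝕜) :
    pair₂ (∑ i ∈ s, t i) α β = ∑ i ∈ s, pair₂ (t i) α β := by simp [pair₂]

theorem pair₃_sum {ι : Type*} (s : Finset ι) (t : ι → V ⊗[𝕜] (V ⊗[𝕜] V)) (α β γ : V →ₗ[𝕜] 𝕜) :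
    pair₃ (∑ i ∈ s, t i) α β γ = ∑ i ∈ s, pair₃ (t i) α β γ := by simp [pair₃]

/-- A 2-tensor as a bilinear form on covectors. -/
def pairForm (t : V ⊗[𝕜] V) : (V →ₗ[𝕜] 𝕜) →ₗ[𝕜] (V →ₗ[𝕜] 𝕜) →ₗ[𝕜] 𝕜 :=
  LinearMap.mk₂ 𝕜 (pair₂ t)
    (by intros; simp [pair₂, TensorProduct.map_add_left])
    (by intros; simp [pair₂, TensorProduct.map_smul_left])
    (by intros; simp [pair₂, TensorProduct.map_add_right])
    (by intros; simp [pair₂, TensorProduct.map_smul_right])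

theorem pairForm_apply (t : V ⊗[𝕜] V) (α β : V →ₗ[𝕜] 𝕜) : pairForm t α β = pair₂ t α β := rfl

theorem pair₂_map (f : V →ₗ[𝕜] W) (t : V ⊗[𝕜] V) (α β : W →ₗ[𝕜] 𝕜) :
    pair₂ (TensorProduct.map f f t) α β = pair₂ t (α ∘ₗ f) (β ∘ₗ f) := by
  simp [pair₂, TensorProduct.map_comp]

theorem pair₃_map₃ (f : V →ₗ[𝕜] W) (t : V ⊗[𝕜] (V ⊗[𝕜] V)) (α β γ : W →ₗ[𝕜] 𝕜) :
    pair₃ (map₃ f t) α β γ = pair₃ t (α ∘ₗ f) (β ∘ₗ f) (γ ∘ₗ f) := by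
  induction t with
  | zero => simp
  | add t t' h h' => simp [h, h']
  | tmul a t =>
    induction t with
    | zero => simp
    | add t t' h h' => simp [h, h', TensorProduct.tmul_add]
    | tmul b c => simp [map₃]

theorem pair₂_flip (t : V ⊗[𝕜] V) (α β : V →ₗ[𝕜] 𝕜) : pair₂ (flip t) α β = pair₂ t β α := by
  induction t with
  | zero => simp [flip]
  | add t t' h h' => simp only [flip, map_add, pair₂_add] at *; rw [h, h']
  | tmul a b => simp [flip, mul_comm]

end Pairings

/-! ### Symmetric and skew-symmetric parts -/

section Flip

variable {𝕜 : Type*} [RCLike 𝕜] {V W : Type*} [AddCommGroup V] [Module 𝕜 V]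
  [AddCommGroup W] [Module 𝕜 W]

@[simp] theorem flip_tmul (a b : V) : flip (a ⊗ₜ[𝕜] b) = b ⊗ₜ a := rfl
@[simp] theorem flip_add (t t' : V ⊗[𝕜] V) : flip (t + t') = flip t + flip t' := map_add _ _ _
@[simp] theorem flip_sub (t t' : V ⊗[𝕜] V) : flip (t - t') = flip t - flip t' := map_sub _ _ _
@[simp] theorem flip_neg (t : V ⊗[𝕜] V) : flip (-t) = -flip t := map_neg _ _
@[simp] theorem flip_zero : flip (0 : V ⊗[𝕜] V) = 0 := map_zero _
@[simp] theorem flip_smul (c : 𝕜) (t : V ⊗[𝕜] V) : flip (c • t) = c • flip t := map_smul _ _ _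
@[simp] theorem flip_flip (t : V ⊗[𝕜] V) : flip (flip t) = t := by
  simp [flip]

theorem flip_map (f g : V →ₗ[𝕜] W) (t : V ⊗[𝕜] V) :
    flip (TensorProduct.map f g t) = TensorProduct.map g f (flip t) := by
  simp [flip, TensorProduct.map_comm]

theorem flip_symPart (r : V ⊗[𝕜] V) : flip (symPart r) = symPart r := by
  simp [symPart, add_comm]

theorem flip_skewPart (r : V ⊗[𝕜] V) : flip (skewPart r) = -skewPart r := by
  simp [skewPart, ← smul_neg]

theorem skewPart_add_symPart (r : V ⊗[𝕜] V) : skewPart r + symPart r = r := by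
  rw [skewPart, symPart, ← smul_add, sub_add_add_cancel, ← two_smul 𝕜 r, smul_smul]
  simp

theorem neg_flip_eq (r : V ⊗[𝕜] V) : -flip r = r - (2 : 𝕜) • symPart r := by
  simp [symPart, smul_smul]

end Flip

/-! ### The Yang-Baxter operator and invariance of the symmetric part -/

section CYB

variable {𝕜 : Type*} [RCLike 𝕜] {L : Type*} [LieRing L] [LieAlgebra 𝕜 L]

theorem lie_skewPart (r : L ⊗[𝕜] L) (h : ∀ x : L, ⁅x, symPart r⁆ = 0) (x : L) :
    ⁅x, skewPart r⁆ = ⁅x, r⁆ := by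
  conv_rhs => rw [← skewPart_add_symPart r, lie_add, h, add_zero]

/-- `(q, q') ↦ [q₁₂, q'₁₃]`. -/
def cyb₁ : L ⊗[𝕜] L →ₗ[𝕜] L ⊗[𝕜] L →ₗ[𝕜] L ⊗[𝕜] (L ⊗[𝕜] L) :=
  TensorProduct.map₂ lieBilin (TensorProduct.mk 𝕜 L L)

/-- `(q, q') ↦ [q₁₃, q'₂₃]`. -/
def cyb₃ : L ⊗[𝕜] L →ₗ[𝕜] L ⊗[𝕜] L →ₗ[𝕜] L ⊗[𝕜] (L ⊗[𝕜] L) :=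
  (TensorProduct.map₂ (TensorProduct.mk 𝕜 L L) lieBilin).compr₂
      (TensorProduct.assoc 𝕜 L L L).toLinearMap

/-- `(q, q') ↦ [q₁₂, q'₂₃]`. -/
def cyb₂ : L ⊗[𝕜] L →ₗ[𝕜] L ⊗[𝕜] L →ₗ[𝕜] L ⊗[𝕜] (L ⊗[𝕜] L) := cybBilin - cyb₁ - cyb₃

@[simp] theorem cyb₁_tmul (a b c d : L) :
    cyb₁ (𝕜 := 𝕜) (a ⊗ₜ b) (c ⊗ₜ d) = ⁅a, c⁆ ⊗ₜ (b ⊗ₜ d) := by simp [cyb₁, lieBilin]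

@[simp] theorem cyb₃_tmul (a b c d : L) :
    cyb₃ (𝕜 := 𝕜) (a ⊗ₜ b) (c ⊗ₜ d) = a ⊗ₜ (c ⊗ₜ ⁅b, d⁆) := by simp [cyb₃, lieBilin]

@[simp] theorem cyb₂_tmul (a b c d : L) :
    cyb₂ (𝕜 := 𝕜) (a ⊗ₜ b) (c ⊗ₜ d) = a ⊗ₜ (⁅b, c⁆ ⊗ₜ d) := by
  simp only [cyb₂, LinearMap.sub_apply, cybBilin_tmul, cyb₁_tmul, cyb₃_tmul]; abel

theorem cybBilin_eq (t u : L ⊗[𝕜] L) :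
    cybBilin t u = cyb₁ t u + cyb₂ t u + cyb₃ t u := by
  simp only [cyb₂, LinearMap.sub_apply]; abel

/-- The mixed Yang-Baxter expression `[X₁₂, Y₁₃] + [X₁₂, Z₂₃] + [Y₁₃, Z₂₃]`. -/
def mixedCyb (X Y Z : L ⊗[𝕜] L) : L ⊗[𝕜] (L ⊗[𝕜] L) := cyb₁ X Y + cyb₂ X Z + cyb₃ Y Z

theorem cyb_eq_mixedCyb (r : L ⊗[𝕜] L) : cyb r = mixedCyb r r r := cybBilin_eq r r

/-- If `s` is invariant, `s₁₂` commutes with `Y₁₃ + Y₂₃`. -/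
theorem cyb₁_add_cyb₂_of_invariant {s : L ⊗[𝕜] L} (hs : ∀ x : L, ⁅x, s⁆ = 0) (Y : L ⊗[𝕜] L) :
    cyb₁ s Y + cyb₂ s Y = 0 := by
  induction Y with
  | zero => simp
  | add Y Y' h h' => rw [map_add, map_add, add_add_add_comm, h, h', add_zero]
  | tmul c d =>
    -- Invariance is not inherited by the summands of `s`, so the induction runs on an identity
    -- valid for every `t`, with the obstruction `ad_c t` made explicit. The next two lemmas use the
    -- same device.
    have key : ∀ t : L ⊗[𝕜] L, cyb₁ t (c ⊗ₜ d) + cyb₂ t (c ⊗ₜ d) =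
        -(TensorProduct.assoc 𝕜 L L L (⁅c, t⁆ ⊗ₜ d)) := by
      intro t
      induction t with
      | zero => simp
      | add t t' h h' =>
        rw [map_add, map_add, LinearMap.add_apply, LinearMap.add_apply, add_add_add_comm, h, h',
          lie_add, TensorProduct.add_tmul, map_add, neg_add]
      | tmul a b =>
        rw [cyb₁_tmul, cyb₂_tmul, ← lie_skew a c, ← lie_skew b c]
        simp only [TensorProduct.LieModule.lie_tmul_right, TensorProduct.add_tmul, map_add,
          TensorProduct.neg_tmul, TensorProduct.tmul_neg, TensorProduct.assoc_tmul, neg_add]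
    rw [key, hs]; simp

/-- If `s` is invariant, `s₂₃` commutes with `X₁₂ + X₁₃`. -/
theorem cyb₂_add_cyb₃_of_invariant {s : L ⊗[𝕜] L} (hs : ∀ x : L, ⁅x, s⁆ = 0) (X : L ⊗[𝕜] L) :
    cyb₂ X s + cyb₃ X s = 0 := by
  induction X with
  | zero => simp
  | add Y Y' h h' =>
    rw [map_add, map_add, LinearMap.add_apply, LinearMap.add_apply, add_add_add_comm, h, h',
      add_zero]
  | tmul a b =>
    have key : ∀ t : L ⊗[𝕜] L, cyb₂ (a ⊗ₜ b) t + cyb₃ (a ⊗ₜ b) t = a ⊗ₜ ⁅b, t⁆ := by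
      intro t
      induction t with
      | zero => simp
      | add t t' h h' =>
        rw [map_add, map_add, add_add_add_comm, h, h', lie_add, TensorProduct.tmul_add]
      | tmul c d => simp [TensorProduct.LieModule.lie_tmul_right, TensorProduct.tmul_add]
    rw [key, hs]; simp

/-- If `s` is invariant, `s₁₃` commutes with `X₁₂ + X₃₂`. -/
theorem cyb₁_sub_cyb₃_of_invariant {s : L ⊗[𝕜] L} (hs : ∀ x : L, ⁅x, s⁆ = 0) (X : L ⊗[𝕜] L) :
    cyb₁ X s - cyb₃ s (flip X) = 0 := by
  induction X with
  | zero => simp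
  | add Y Y' h h' =>
    rw [flip_add, map_add, map_add, LinearMap.add_apply, add_sub_add_comm, h, h', add_zero]
  | tmul a b =>
    have key : ∀ t : L ⊗[𝕜] L, cyb₁ (a ⊗ₜ b) t - cyb₃ t (b ⊗ₜ a) =
        TensorProduct.leftComm 𝕜 L L L (b ⊗ₜ ⁅a, t⁆) := by
      intro t
      induction t with
      | zero => simp
      | add t t' h h' =>
        rw [map_add, map_add, LinearMap.add_apply, add_sub_add_comm, h, h', lie_add,
          TensorProduct.tmul_add, map_add]
      | tmul c d =>
        rw [cyb₁_tmul, cyb₃_tmul, ← lie_skew d a]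
        simp only [TensorProduct.LieModule.lie_tmul_right, TensorProduct.tmul_add, map_add,
          TensorProduct.leftComm_tmul, TensorProduct.tmul_neg, sub_neg_eq_add]
    rw [flip_tmul, key, hs]; simp

/-- The mixed Yang-Baxter equations between `r` and `-r²¹`. -/
theorem IsQuasitriangular.mixedCyb_eq_zero {r : L ⊗[𝕜] L} (hr : IsQuasitriangular r)
    (x y z : Prop) [Decidable x] [Decidable y] [Decidable z]
    (h : ¬(x ∧ ¬y ∧ z)) (h' : ¬(¬x ∧ y ∧ ¬z)) :
    mixedCyb (if x then r else -flip r) (if y then r else -flip r)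
      (if z then r else -flip r) = 0 := by
  obtain ⟨hs, h0⟩ := hr
  rw [cyb_eq_mixedCyb] at h0
  have e := neg_flip_eq r
  -- As `-r²¹ = r - 2s`, each of the three commutation rules for `s` lets one entry switch between
  -- `r` and `-r²¹`: the first if the other two agree, the third if the other two agree, the middle
  -- one if the third entry is `-X²¹`. Starting from `CYB(r) = 0` these moves reach all six
  -- admissible patterns. The excluded ones are `(r, -r²¹, r)` and `(-r²¹, r, -r²¹)`.
  have moveX : ∀ Y, mixedCyb (-flip r) Y Y = mixedCyb r Y Y := fun Y => by
    have := cyb₁_add_cyb₂_of_invariant hs Y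
    simp only [mixedCyb, e, map_sub, map_smul, LinearMap.sub_apply, LinearMap.smul_apply]
    linear_combination (norm := module) (-2 : 𝕜) • this
  have moveZ : ∀ X, mixedCyb X X (-flip r) = mixedCyb X X r := fun X => by
    have := cyb₂_add_cyb₃_of_invariant hs X
    simp only [mixedCyb, e, map_sub, map_smul]
    linear_combination (norm := module) (-2 : 𝕜) • this
  have moveY : ∀ X, mixedCyb X (-flip r) (-flip X) = mixedCyb X r (-flip X) := fun X => by
    have := cyb₁_sub_cyb₃_of_invariant hs X
    simp only [mixedCyb, e, map_sub, map_smul, map_neg, LinearMap.sub_apply, LinearMap.smul_apply]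
    linear_combination (norm := module) (-2 : 𝕜) • this
  have m1 : mixedCyb (-flip r) r r = 0 := by rw [moveX, h0]
  have m2 : mixedCyb r r (-flip r) = 0 := by rw [moveZ, h0]
  have m3 : mixedCyb r (-flip r) (-flip r) = 0 := by rw [moveY, m2]
  have m4 : mixedCyb (-flip r) (-flip r) r = 0 := by
    have := moveY (-flip r)
    simp only [flip_neg, flip_flip, neg_neg] at this
    rw [this, m1]
  have m5 : mixedCyb (-flip r) (-flip r) (-flip r) = 0 := by rw [moveZ, m4]
  by_cases x <;> by_cases y <;> by_cases z <;> simp_all only [if_true, if_false, not_true,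
    not_false_eq_true, and_self, and_true, and_false]

theorem cyb_neg (t : L ⊗[𝕜] L) : cyb (-t) = cyb t := by simp [cyb]

/-- `CYB(Λ) = -CYB(s)` for a quasitriangular `r = Λ + s`. -/
theorem IsQuasitriangular.two_smul_cyb_skewPart {r : L ⊗[𝕜] L} (hr : IsQuasitriangular r) :
    (2 : 𝕜) • cyb (skewPart r) = phi (symPart r) := by
  obtain ⟨hs, h0⟩ := hr
  -- The six cross terms of `CYB(Λ + s)` cancel in three pairs, one for each position of `s`.
  have h1 := cyb₁_add_cyb₂_of_invariant hs (skewPart r)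
  have h2 := cyb₂_add_cyb₃_of_invariant hs (skewPart r)
  have h3 := cyb₁_sub_cyb₃_of_invariant hs (skewPart r)
  rw [flip_skewPart, map_neg, sub_neg_eq_add] at h3
  rw [← skewPart_add_symPart r] at h0
  simp only [cyb, cybBilin_eq, map_add, LinearMap.add_apply, phi] at h0 ⊢
  linear_combination (norm := module) (2 : 𝕜) • h0 - (2 : 𝕜) • (h1 + h2 + h3)

end CYB

/-! ### Cyclic sums and the Yang-Baxter operator -/

section Cyclic

variable {𝕜 : Type*} [RCLike 𝕜] {L : Type*} [LieRing L] [LieAlgebra 𝕜 L]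

/-- Rotating the three slots brings the bracket to the first one. With the analogue for `cyb₃`, all
Yang-Baxter terms become rotations of a single expression. -/
theorem pair₃_cyb₂ (t u : L ⊗[𝕜] L) (α β γ : L →ₗ[𝕜] 𝕜) :
    pair₃ (cyb₂ t u) α β γ = -pair₃ (cyb₁ u (flip t)) β γ α := by
  induction t with
  | zero => simp
  | add t t' h h' => simp only [map_add, flip_add, LinearMap.add_apply, pair₃_add, h, h']; ring
  | tmul a b =>
    induction u with
    | zero => simp
    | add u u' h h' => simp only [map_add, LinearMap.add_apply, pair₃_add, h, h']; ring
    | tmul c d =>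
      simp only [cyb₂_tmul, flip_tmul, cyb₁_tmul, pair₃_tmul, ← lie_skew b c, map_neg]; ring

theorem pair₃_cyb₃ (t u : L ⊗[𝕜] L) (α β γ : L →ₗ[𝕜] 𝕜) :
    pair₃ (cyb₃ t u) α β γ = pair₃ (cyb₁ (flip t) (flip u)) γ α β := by
  induction t with
  | zero => simp
  | add t t' h h' => simp only [map_add, flip_add, LinearMap.add_apply, pair₃_add, h, h']
  | tmul a b =>
    induction u with
    | zero => simp
    | add u u' h h' => simp only [map_add, flip_add, pair₃_add, h, h']
    | tmul c d => simp only [cyb₃_tmul, flip_tmul, cyb₁_tmul, pair₃_tmul]; ring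

/-- The adjoint action is a derivation of the tensor product. This links the trivectors produced by
Schouten brackets to Yang-Baxter terms. -/
theorem lTensor_coBracket (t u : L ⊗[𝕜] L) :
    LinearMap.lTensor L (coBracket u) t = cyb₂ t u + cyb₃ t u := by
  induction t with
  | zero => simp
  | add t t' h h' => simp only [map_add, LinearMap.add_apply, h, h']; abel
  | tmul a b =>
    induction u with
    | zero => simp [coBracket]
    | add u u' h h' =>
      simp only [LinearMap.lTensor_tmul, coBracket, LinearMap.coe_mk, AddHom.coe_mk, map_add,
        lie_add, TensorProduct.tmul_add] at h h' ⊢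
      rw [h, h']; abel
    | tmul c d =>
      simp [coBracket, TensorProduct.LieModule.lie_tmul_right, TensorProduct.tmul_add]

/-- For skew `Λ = ∑ a ⊗ b`, the cyclic sum of `∑ a ⊗ ad_b Λ` is `2 CYB(Λ)`. -/
theorem cyclic_lTensor_coBracket {t : L ⊗[𝕜] L} (ht : flip t = -t) (α β γ : L →ₗ[𝕜] 𝕜) :
    pair₃ (LinearMap.lTensor L (coBracket t) t) α β γ
      + pair₃ (LinearMap.lTensor L (coBracket t) t) β γ α
      + pair₃ (LinearMap.lTensor L (coBracket t) t) γ α β = pair₃ ((2 : 𝕜) • cyb t) α β γ := by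
  -- For skew `t` the terms `cyb₂ t t` and `cyb₃ t t` are the two nontrivial rotations of `cyb₁ t
  -- t`, with sign `+`. So `CYB(t)` is the sum of all three rotations, and the cyclic sum of two of
  -- them counts each twice.
  simp only [lTensor_coBracket, pair₃_smul, cyb, cybBilin_eq, pair₃_add, pair₃_cyb₂, pair₃_cyb₃,
    ht, map_neg, LinearMap.neg_apply, pair₃_neg]
  ring

end Cyclic

/-! ### Tensors on `V^n` as block matrices -/

section Blocks

variable {𝕜 : Type*} [RCLike 𝕜] {V : Type*} [AddCommGroup V] [Module 𝕜 V] {n : ℕ}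

/-- The 2-tensor on `V^n` with `(j, k)` component `R j k`. -/
def block (R : Fin n → Fin n → V ⊗[𝕜] V) : (Fin n → V) ⊗[𝕜] (Fin n → V) :=
  ∑ j, ∑ k, TensorProduct.map (incl 𝕜 V j) (incl 𝕜 V k) (R j k)

theorem block_add (R R' : Fin n → Fin n → V ⊗[𝕜] V) :
    block (fun j k => R j k + R' j k) = block R + block R' := by
  simp [block, Finset.sum_add_distrib]

theorem block_sub (R R' : Fin n → Fin n → V ⊗[𝕜] V) :
    block (fun j k => R j k - R' j k) = block R - block R' := by
  simp [block, Finset.sum_sub_distrib]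

theorem block_smul (c : 𝕜) (R : Fin n → Fin n → V ⊗[𝕜] V) :
    block (fun j k => c • R j k) = c • block R := by
  simp [block, Finset.smul_sum]

theorem flip_block (R : Fin n → Fin n → V ⊗[𝕜] V) :
    flip (block R) = block (fun j k => flip (R k j)) := by
  unfold block
  rw [Finset.sum_comm]
  simp only [flip, map_sum]
  refine Finset.sum_congr rfl fun j _ => Finset.sum_congr rfl fun k _ => ?_
  exact flip_map _ _ _

theorem block_diagonal (R : Fin n → V ⊗[𝕜] V) :
    block (fun j k => if j = k then R j else 0) =
      ∑ j, TensorProduct.map (incl 𝕜 V j) (incl 𝕜 V j) (R j) := by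
  refine Finset.sum_congr rfl fun j _ => ?_
  rw [Finset.sum_eq_single j] <;> simp +contextual [eq_comm]

theorem copies₂_eq_block (t : V ⊗[𝕜] V) :
    copies₂ n t = block (fun j k => if j = k then t else 0) := (block_diagonal _).symm

theorem alt_eq_block (r : V ⊗[𝕜] V) :
    alt n r = block (fun j k => if j = k then (if Even (j : ℕ) then r else -flip r) else 0) :=
  (block_diagonal _).symm

theorem mix_eq_block (r : V ⊗[𝕜] V) :
    mix n r = block (fun j k => if j < k then flip r else if k < j then -r else 0) := by
  have h : mix n r = block (fun j k => if j < k then flip r else 0)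
      - block (fun j k => if k < j then r else 0) := by
    rw [mix, block, block, Finset.sum_comm (f := fun j k =>
      TensorProduct.map (incl 𝕜 V j) (incl 𝕜 V k) (if k < j then r else 0)),
      ← Finset.sum_sub_distrib]
    refine Finset.sum_congr rfl fun j _ => ?_
    rw [← Finset.sum_sub_distrib]
    refine Finset.sum_congr rfl fun k _ => ?_
    split_ifs <;> simp
  rw [h, ← block_sub]
  congr 1; funext j k
  rcases lt_trichotomy j k with h | h | h
  · simp [h, h.not_gt]
  · simp [h]
  · simp [h, h.not_gt]

/-- The relation that selects `r` is transitive, and so is its negation; this is what the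
Yang-Baxter equation for `r^{(n)}` needs. Indices start at `0`, so `Even` marks the odd positions of
`Altⁿ`. -/
theorem rPow_eq_block (r : V ⊗[𝕜] V) :
    rPow n r = block (fun j k => if k < j ∨ j = k ∧ Even (j : ℕ) then r else -flip r) := by
  rw [rPow, alt_eq_block, mix_eq_block, ← block_sub]
  congr 1; funext j k
  rcases lt_trichotomy j k with h | h | h
  · simp [h, h.ne, h.not_gt]
  · simp [h]
  · simp [h.ne', h, h.not_gt]

theorem sum_incl_comp (n : ℕ) : (∑ j, incl 𝕜 V (n := n) j) = diag 𝕜 V n := by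
  ext v k
  simp [incl, diag, LinearMap.sum_apply, Finset.sum_apply, Pi.single_apply]

theorem map_diag_eq_block (t : V ⊗[𝕜] V) :
    TensorProduct.map (diag 𝕜 V n) (diag 𝕜 V n) t = block (fun _ _ => t) := by
  induction t with
  | zero => simp [block]
  | add t t' h h' => rw [map_add, h, h', ← block_add]
  | tmul a b =>
    simp only [← sum_incl_comp, TensorProduct.map_tmul, LinearMap.sum_apply,
      TensorProduct.sum_tmul, TensorProduct.tmul_sum, block]
    exact Finset.sum_comm

/-- The blocks `(j, k)` and `(k, j)` with `j ≠ k` are exchanged up to sign by the flip, so only the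
diagonal survives. This gives invariance under all of `L^n`, not just under the diagonal. -/
theorem symPart_rPow (r : V ⊗[𝕜] V) :
    symPart (rPow n r) =
      block (fun j k => if j = k then (if Even (j : ℕ) then symPart r else -symPart r) else 0) := by
  rw [symPart, rPow_eq_block, flip_block, ← block_add, ← block_smul]
  congr 1; funext j k
  rcases lt_trichotomy j k with h | rfl | h
  · simp [h, h.ne, h.ne', h.not_gt]
  · by_cases hj : Even (j : ℕ)
    · simp [hj, symPart]
    · simp [hj, symPart, ← smul_neg, add_comm]
  · simp [h, h.ne, h.ne', h.not_gt]

theorem skewPart_rPow (r : V ⊗[𝕜] V) :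
    skewPart (rPow n r) = copies₂ n (skewPart r) - mix n r := by
  rw [skewPart, rPow_eq_block, flip_block, ← block_sub, ← block_smul, copies₂_eq_block,
    mix_eq_block, ← block_sub]
  congr 1; funext j k
  rcases lt_trichotomy j k with h | rfl | h
  · simp only [h, h.ne, h.ne', h.not_gt, false_and, or_false, if_true, if_false]
    module
  · by_cases hj : Even (j : ℕ)
    · simp [hj, skewPart]
    · simp [hj, skewPart, sub_eq_add_neg, add_comm]
  · simp only [h, h.ne, h.ne', h.not_gt, false_and, or_false, if_true, if_false, flip_neg,
      flip_flip]
    module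

/-- The identity behind the commutative square. Off the diagonal the blocks on the right are `-r²¹ +
s` and `r - s`, and both equal `Λ`. -/
theorem map_diag_skewPart_eq (r : V ⊗[𝕜] V) :
    TensorProduct.map (diag 𝕜 V n) (diag 𝕜 V n) (skewPart r) =
      copies₂ n (skewPart r) - mix n r + mix n (symPart r) := by
  rw [map_diag_eq_block, copies₂_eq_block, mix_eq_block, mix_eq_block, ← block_sub, ← block_add]
  congr 1; funext j k
  have e := skewPart_add_symPart r
  rcases lt_trichotomy j k with h | h | h
  · simp only [h, h.ne, if_true, if_false, zero_sub, flip_symPart, neg_flip_eq]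
    linear_combination (norm := module) e
  · simp [h]
  · simp only [h, h.ne', h.not_gt, if_true, if_false, zero_sub, neg_neg]
    linear_combination (norm := module) e

end Blocks

/-! ### The `r`-matrix on the Lie algebra `L^n` -/

section LieBlocks

variable {𝕜 : Type*} [RCLike 𝕜] {L : Type*} [LieRing L] [LieAlgebra 𝕜 L] {n : ℕ}

theorem lie_incl (x : Fin n → L) (j : Fin n) (a : L) :
    ⁅x, incl 𝕜 L j a⁆ = incl 𝕜 L j ⁅x j, a⁆ := by
  funext k
  change ⁅x k, incl 𝕜 L j a k⁆ = _
  by_cases h : k = j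
  · subst h; simp [incl]
  · simp [incl, h]

theorem incl_lie_incl (i j : Fin n) (a b : L) :
    ⁅incl 𝕜 L i a, incl 𝕜 L j b⁆ =
      (if i = j then incl 𝕜 L i else 0 : L →ₗ[𝕜] (Fin n → L)) ⁅a, b⁆ := by
  rw [lie_incl]
  by_cases h : i = j
  · subst h; simp [incl]
  · simp [incl, h, Ne.symm h]

/-- The hypothesis `x j = x k` covers the two uses: `x` on the diagonal, or `j = k`. -/
theorem lie_map_incl (x : Fin n → L) (j k : Fin n) (t : L ⊗[𝕜] L)
    (h : x j = x k) :
    ⁅x, TensorProduct.map (incl 𝕜 L j) (incl 𝕜 L k) t⁆ =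
      TensorProduct.map (incl 𝕜 L j) (incl 𝕜 L k) ⁅x j, t⁆ := by
  induction t with
  | zero => simp
  | add t t' h h' => simp only [map_add, lie_add, h, h']
  | tmul a b =>
    simp only [TensorProduct.map_tmul, TensorProduct.LieModule.lie_tmul_right, lie_incl, map_add, h]

theorem lie_diag_block (x : L) (R : Fin n → Fin n → L ⊗[𝕜] L) :
    ⁅diag 𝕜 L n x, block R⁆ = block (fun j k => ⁅x, R j k⁆) := by
  simp only [block, lie_sum]
  refine Finset.sum_congr rfl fun j _ => Finset.sum_congr rfl fun k _ => ?_
  exact lie_map_incl _ j k _ rfl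

theorem lie_block_diagonal (x : Fin n → L) (R : Fin n → L ⊗[𝕜] L) :
    ⁅x, block (fun j k => if j = k then R j else 0)⁆ =
      block (fun j k => if j = k then ⁅x j, R j⁆ else 0) := by
  simp only [block_diagonal, lie_sum]
  exact Finset.sum_congr rfl fun j _ => lie_map_incl _ j j _ rfl

/-- Each block is `r` or `r - 2s`, hence has the same image under `ad_x` for `x` acting diagonally.
This compatibility of co-brackets is why `Res` preserves Poisson spaces. -/
theorem coBracket_rPow_diag {r : L ⊗[𝕜] L} (hr : IsQuasitriangular r) (x : L) :
    coBracket (rPow n r) (diag 𝕜 L n x) =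
      TensorProduct.map (diag 𝕜 L n) (diag 𝕜 L n) (coBracket r x) := by
  change ⁅diag 𝕜 L n x, rPow n r⁆ = TensorProduct.map _ _ ⁅x, r⁆
  rw [rPow_eq_block, lie_diag_block, map_diag_eq_block]
  have h : ⁅x, -flip r⁆ = ⁅x, r⁆ := by
    rw [neg_flip_eq, lie_sub, lie_smul, hr.1]; simp
  congr 1; funext j k
  split_ifs <;> simp only [h]

section Yang

variable {L' : Type*} [LieRing L'] [LieAlgebra 𝕜 L']

/-- The map `e` records how the two bracketed slots interact. For inclusions of summands it is again
an inclusion if the summands agree, and `0` otherwise. -/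
theorem cyb₁_map (f g f' h e : L →ₗ[𝕜] L') (H : ∀ a b : L, ⁅f a, f' b⁆ = e ⁅a, b⁆)
    (t u : L ⊗[𝕜] L) :
    cyb₁ (TensorProduct.map f g t) (TensorProduct.map f' h u) =
      TensorProduct.map e (TensorProduct.map g h) (cyb₁ t u) := by
  induction t with
  | zero => simp
  | add t t' h h' => simp only [map_add, LinearMap.add_apply, h, h']
  | tmul a b =>
    induction u with
    | zero => simp
    | add u u' h h' => simp only [map_add, h, h']
    | tmul c d => simp [H]

theorem cyb₂_map (f g f' h e : L →ₗ[𝕜] L') (H : ∀ a b : L, ⁅g a, f' b⁆ = e ⁅a, b⁆)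
    (t u : L ⊗[𝕜] L) :
    cyb₂ (TensorProduct.map f g t) (TensorProduct.map f' h u) =
      TensorProduct.map f (TensorProduct.map e h) (cyb₂ t u) := by
  induction t with
  | zero => simp
  | add t t' h h' => simp only [map_add, LinearMap.add_apply, h, h']
  | tmul a b =>
    induction u with
    | zero => simp
    | add u u' h h' => simp only [map_add, h, h']
    | tmul c d => simp [H]

theorem cyb₃_map (f g f' h e : L →ₗ[𝕜] L') (H : ∀ a b : L, ⁅g a, h b⁆ = e ⁅a, b⁆)
    (t u : L ⊗[𝕜] L) :
    cyb₃ (TensorProduct.map f g t) (TensorProduct.map f' h u) =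
      TensorProduct.map f (TensorProduct.map f' e) (cyb₃ t u) := by
  induction t with
  | zero => simp
  | add t t' h h' => simp only [map_add, LinearMap.add_apply, h, h']
  | tmul a b =>
    induction u with
    | zero => simp
    | add u u' h h' => simp only [map_add, h, h']
    | tmul c d => simp [H]

end Yang

/-- The embedding of `L ⊗ L ⊗ L` in the component `(i, j, k)`. -/
abbrev incl₃ (i j k : Fin n) : L ⊗[𝕜] (L ⊗[𝕜] L) →ₗ[𝕜]
    (Fin n → L) ⊗[𝕜] ((Fin n → L) ⊗[𝕜] (Fin n → L)) :=
  TensorProduct.map (incl 𝕜 L i) (TensorProduct.map (incl 𝕜 L j) (incl 𝕜 L k))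

theorem bilin_block {M : Type*} [AddCommGroup M] [Module 𝕜 M]
    (B : (Fin n → L) ⊗[𝕜] (Fin n → L) →ₗ[𝕜] (Fin n → L) ⊗[𝕜] (Fin n → L) →ₗ[𝕜] M)
    (R R' : Fin n → Fin n → L ⊗[𝕜] L) :
    B (block R) (block R') = ∑ i, ∑ j, ∑ i', ∑ k,
      B (TensorProduct.map (incl 𝕜 L i) (incl 𝕜 L j) (R i j))
        (TensorProduct.map (incl 𝕜 L i') (incl 𝕜 L k) (R' i' k)) := by
  unfold block
  rw [map_sum B, LinearMap.sum_apply]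
  refine Finset.sum_congr rfl fun i _ => ?_
  rw [map_sum B, LinearMap.sum_apply]
  refine Finset.sum_congr rfl fun j _ => ?_
  rw [map_sum]
  exact Finset.sum_congr rfl fun i' _ => map_sum _ _ _

theorem cyb₁_block (R R' : Fin n → Fin n → L ⊗[𝕜] L) :
    cyb₁ (block R) (block R') = ∑ i, ∑ j, ∑ k, incl₃ i j k (cyb₁ (R i j) (R' i k)) := by
  rw [bilin_block]
  refine Finset.sum_congr rfl fun i _ => Finset.sum_congr rfl fun j _ => ?_
  rw [Finset.sum_eq_single i]
  · refine Finset.sum_congr rfl fun k _ => ?_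
    rw [cyb₁_map _ _ _ _ _ (incl_lie_incl (𝕜 := 𝕜) i i), if_pos rfl]
  · intro i' _ hi
    refine Finset.sum_eq_zero fun k _ => ?_
    rw [cyb₁_map _ _ _ _ _ (incl_lie_incl (𝕜 := 𝕜) i i'), if_neg hi.symm]
    simp
  · simp

theorem cyb₂_block (R R' : Fin n → Fin n → L ⊗[𝕜] L) :
    cyb₂ (block R) (block R') = ∑ i, ∑ j, ∑ k, incl₃ i j k (cyb₂ (R i j) (R' j k)) := by
  rw [bilin_block]
  refine Finset.sum_congr rfl fun i _ => Finset.sum_congr rfl fun j _ => ?_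
  rw [Finset.sum_eq_single j]
  · refine Finset.sum_congr rfl fun k _ => ?_
    rw [cyb₂_map _ _ _ _ _ (incl_lie_incl (𝕜 := 𝕜) j j), if_pos rfl]
  · intro i' _ hi
    refine Finset.sum_eq_zero fun k _ => ?_
    rw [cyb₂_map _ _ _ _ _ (incl_lie_incl (𝕜 := 𝕜) j i'), if_neg hi.symm]
    simp
  · simp

theorem cyb₃_block (R R' : Fin n → Fin n → L ⊗[𝕜] L) :
    cyb₃ (block R) (block R') = ∑ i, ∑ j, ∑ k, incl₃ i j k (cyb₃ (R i k) (R' j k)) := by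
  rw [bilin_block]
  refine Finset.sum_congr rfl fun i _ => ?_
  simp_rw [Finset.sum_comm (γ := Fin n) (s := Finset.univ) (t := Finset.univ)
    (f := fun j k => incl₃ i j k (cyb₃ (R i k) (R' j k)))]
  refine Finset.sum_congr rfl fun k _ => Finset.sum_congr rfl fun j _ => ?_
  rw [Finset.sum_eq_single k]
  · rw [cyb₃_map _ _ _ _ _ (incl_lie_incl (𝕜 := 𝕜) k k), if_pos rfl]
  · intro i' _ hi
    rw [cyb₃_map _ _ _ _ _ (incl_lie_incl (𝕜 := 𝕜) k i'), if_neg hi.symm]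
    simp
  · simp

/-- Different summands of `L^n` commute, so a bracket survives only where the two indices of its
slot coincide, and each component involves just three blocks. -/
theorem cyb_block (R : Fin n → Fin n → L ⊗[𝕜] L) :
    cyb (block R) = ∑ i, ∑ j, ∑ k, incl₃ i j k (mixedCyb (R i j) (R i k) (R j k)) := by
  simp only [cyb_eq_mixedCyb, mixedCyb, cyb₁_block, cyb₂_block, cyb₃_block, map_add,
    Finset.sum_add_distrib]

theorem IsQuasitriangular.rPow {r : L ⊗[𝕜] L} (hr : IsQuasitriangular r) (n : ℕ) :
    IsQuasitriangular (rPow n r) := by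
  constructor
  · intro x
    rw [symPart_rPow, lie_block_diagonal]
    have : ∀ j : Fin n, ⁅x j, if Even (j : ℕ) then symPart r else -symPart r⁆ = 0 := by
      intro j; split_ifs <;> simp [hr.1]
    simp [this, block]
  · rw [rPow_eq_block, cyb_block]
    refine Finset.sum_eq_zero fun i _ => Finset.sum_eq_zero fun j _ =>
      Finset.sum_eq_zero fun k _ => ?_
    -- The two excluded sign patterns would contradict transitivity of the relation selecting `r`,
    -- respectively of its negation.
    rw [hr.mixedCyb_eq_zero, map_zero] <;> simp only [Fin.lt_def, Fin.ext_iff] <;> grind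

/-- The symmetric part is block diagonal with entries `±s`, and `CYB` is quadratic, so the
alternating signs disappear. -/
theorem phi_symPart_rPow (r : L ⊗[𝕜] L) (n : ℕ) :
    phi (symPart (rPow n r)) = copies₃ n (phi (symPart r)) := by
  rw [symPart_rPow, phi, cyb_block, copies₃, Finset.smul_sum]
  refine Finset.sum_congr rfl fun i _ => ?_
  rw [Finset.sum_eq_single i, Finset.sum_eq_single i]
  · simp only [if_true]
    rw [← cyb_eq_mixedCyb]
    split_ifs
    · simp [map₃, phi]
    · simp [map₃, phi, cyb_neg]
  · intro k _ hk
    simp [hk.symm, mixedCyb]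
  · simp
  · intro j _ hj
    refine Finset.sum_eq_zero fun k _ => ?_
    by_cases hik : i = k
    · subst hik; simp [hj, hj.symm, mixedCyb]
    · simp [hj.symm, hik, mixedCyb]
  · simp

end LieBlocks

open Filter Topology

/-! ### Differentials, vector fields and Lie brackets in charts -/

section LocalAnalysis

variable {𝕜 : Type w} [RCLike 𝕜] {M : Mfd.{w, u} 𝕜} {y : M.carrier} {f g : M.carrier → 𝕜}

namespace Mfd

theorem SmoothAt.mdifferentiableAt (hf : M.SmoothAt f y) :
    MDifferentiableAt 𝓘(𝕜, M.E) 𝓘(𝕜, 𝕜) f y :=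
  ContMDiffAt.mdifferentiableAt hf (by simp)

theorem SmoothAt.add (hf : M.SmoothAt f y) (hg : M.SmoothAt g y) : M.SmoothAt (f + g) y :=
  ContMDiffAt.add hf hg

theorem SmoothAt.sub (hf : M.SmoothAt f y) (hg : M.SmoothAt g y) : M.SmoothAt (f - g) y :=
  ContMDiffAt.sub hf hg

theorem SmoothAt.mul (hf : M.SmoothAt f y) (hg : M.SmoothAt g y) : M.SmoothAt (f * g) y :=
  ContMDiffAt.mul hf hg

theorem smoothAt_const (c : 𝕜) : M.SmoothAt (fun _ => c) y := contMDiffAt_const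

theorem SmoothAt.congr (hf : M.SmoothAt f y) (h : g =ᶠ[𝓝 y] f) : M.SmoothAt g y :=
  ContMDiffAt.congr_of_eventuallyEq hf h

theorem SmoothAt.sum {ι : Type*} (s : Finset ι) {F : ι → M.carrier → 𝕜}
    (hF : ∀ i ∈ s, M.SmoothAt (F i) y) : M.SmoothAt (fun z => ∑ i ∈ s, F i z) y := by
  classical
  induction s using Finset.induction_on with
  | empty => simpa using smoothAt_const 0
  | insert i s hi ih =>
    simp only [Finset.sum_insert hi]
    exact (hF i (by simp)).add (ih fun j hj => hF j (by simp [hj]))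

theorem d_congr (h : f =ᶠ[𝓝 y] g) : M.d f y = M.d g y := by
  simp only [d, mvfderiv, h.mfderiv_eq]; rfl

theorem d_add (hf : M.SmoothAt f y) (hg : M.SmoothAt g y) :
    M.d (f + g) y = M.d f y + M.d g y := by
  simp only [d, mvfderiv_add hf.mdifferentiableAt hg.mdifferentiableAt]; rfl

theorem d_sub (hf : M.SmoothAt f y) (hg : M.SmoothAt g y) :
    M.d (f - g) y = M.d f y - M.d g y := by
  simp only [d, mvfderiv_sub hf.mdifferentiableAt hg.mdifferentiableAt]; rfl

theorem d_neg : M.d (-f) y = -M.d f y := by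
  simp only [d, mvfderiv_neg]; rfl

theorem d_mul (hf : M.SmoothAt f y) (hg : M.SmoothAt g y) :
    M.d (f * g) y = f y • M.d g y + g y • M.d f y := by
  simp only [d, mvfderiv_mul hf.mdifferentiableAt hg.mdifferentiableAt]; rfl

theorem d_const (c : 𝕜) : M.d (fun _ => c) y = 0 := by
  simp only [d, mvfderiv_const]; rfl

theorem d_zero : M.d 0 y = 0 := d_const 0

variable (M) in
/-- The chart at `y`. -/
abbrev chart (y : M.carrier) : PartialEquiv M.carrier M.E := extChartAt 𝓘(𝕜, M.E) y

variable (M) in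
/-- The expression of a function in the chart at `y`. -/
def rep (y : M.carrier) (f : M.carrier → 𝕜) : M.E → 𝕜 := f ∘ (M.chart y).symm

variable (M) in
/-- The differential of the chart at `y`, in the point `z`. -/
def dchart (y z : M.carrier) : M.T z →L[𝕜] M.E :=
  mfderiv 𝓘(𝕜, M.E) 𝓘(𝕜, M.E) (M.chart y) z

variable (M) in
/-- The function obtained from a linear form by composition with the chart at `y`. -/
def coord (y : M.carrier) (ℓ : M.E →L[𝕜] 𝕜) : M.carrier → 𝕜 := ℓ ∘ M.chart y

theorem smoothAt_iff_rep : M.SmoothAt f y ↔ ContDiffAt 𝕜 ∞ (M.rep y f) (M.chart y y) := by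
  rw [SmoothAt, contMDiffAt_iff_source]
  simp only [modelWithCornersSelf_coe, Set.range_id, contMDiffWithinAt_univ]
  exact contMDiffAt_iff_contDiffAt

theorem smoothAt_comp_chart {F : M.E → 𝕜} (hF : ContDiffAt 𝕜 ∞ F (M.chart y y)) :
    M.SmoothAt (F ∘ M.chart y) y :=
  ContMDiffAt.comp y (contMDiffAt_iff_contDiffAt.2 hF) contMDiffAt_extChartAt

theorem chart_source_mem : ∀ᶠ z in 𝓝 y, z ∈ (M.chart y).source :=
  extChartAt_source_mem_nhds y

theorem eventually_chart_source_mem {z : M.carrier} (hz : z ∈ (M.chart y).source) :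
    ∀ᶠ z' in 𝓝 z, z' ∈ (M.chart y).source :=
  extChartAt_source_mem_nhds' hz

theorem continuousAt_chart : ContinuousAt (M.chart y) y := continuousAt_extChartAt y

theorem continuousAt_chart_symm : ContinuousAt (M.chart y).symm (M.chart y y) :=
  continuousAt_extChartAt_symm y

theorem tendsto_chart_symm : Tendsto (M.chart y).symm (𝓝 (M.chart y y)) (𝓝 y) := by
  have := (continuousAt_chart_symm (M := M) (y := y)).tendsto
  rwa [extChartAt_to_inv y] at this

theorem eventually_chart_target : ∀ᶠ p in 𝓝 (M.chart y y), p ∈ (M.chart y).target :=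
  extChartAt_target_mem_nhds y

theorem d_comp_chart {F : M.E → 𝕜} {z : M.carrier} (hz : z ∈ (M.chart y).source)
    (hF : DifferentiableAt 𝕜 F (M.chart y z)) (v : M.T z) :
    M.d (F ∘ M.chart y) z v = fderiv 𝕜 F (M.chart y z) (M.dchart y z v) := by
  have hz' : z ∈ (chartAt M.E y).source := by rwa [← extChartAt_source (I := 𝓘(𝕜, M.E))]
  have h := mfderiv_comp_apply (I := 𝓘(𝕜, M.E)) (I' := 𝓘(𝕜, M.E)) (I'' := 𝓘(𝕜, 𝕜)) z
    (mdifferentiableAt_iff_differentiableAt.2 hF) (mdifferentiableAt_extChartAt hz') v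
  rw [mfderiv_eq_fderiv] at h
  exact h

theorem rep_comp_chart {z : M.carrier} (hz : z ∈ (M.chart y).source) :
    f =ᶠ[𝓝 z] M.rep y f ∘ M.chart y := by
  filter_upwards [eventually_chart_source_mem hz] with z' hz'
  simp only [rep, Function.comp_apply, (M.chart y).left_inv hz']

theorem d_eq_fderiv_rep {z : M.carrier} (hz : z ∈ (M.chart y).source)
    (hF : DifferentiableAt 𝕜 (M.rep y f) (M.chart y z)) (v : M.T z) :
    M.d f z v = fderiv 𝕜 (M.rep y f) (M.chart y z) (M.dchart y z v) := by
  rw [d_congr (rep_comp_chart hz), d_comp_chart hz hF]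

theorem SmoothAt.eventually_differentiableAt_rep (hf : M.SmoothAt f y) :
    ∀ᶠ p in 𝓝 (M.chart y y), DifferentiableAt 𝕜 (M.rep y f) p := by
  have h := ((smoothAt_iff_rep.1 hf).of_le (m := 1) (by simp)).eventually (by simp)
  filter_upwards [h] with p hp using hp.differentiableAt (by simp)

theorem SmoothAt.eventually_d_eq (hf : M.SmoothAt f y) :
    ∀ᶠ z in 𝓝 y, ∀ v : M.T z,
      M.d f z v = fderiv 𝕜 (M.rep y f) (M.chart y z) (M.dchart y z v) := by
  filter_upwards [chart_source_mem,
    continuousAt_chart.eventually hf.eventually_differentiableAt_rep] with z hz h v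
  exact d_eq_fderiv_rep hz h v

theorem smoothAt_coord (ℓ : M.E →L[𝕜] 𝕜) : M.SmoothAt (M.coord y ℓ) y :=
  smoothAt_comp_chart ℓ.contDiff.contDiffAt

theorem d_coord {z : M.carrier} (hz : z ∈ (M.chart y).source) (ℓ : M.E →L[𝕜] 𝕜) (v : M.T z) :
    M.d (M.coord y ℓ) z v = ℓ (M.dchart y z v) := by
  rw [coord, d_comp_chart hz ℓ.differentiableAt, ℓ.fderiv]

variable (M) in
/-- The linear forms of a basis of the model space. -/
def cov (k : Fin (Module.finrank 𝕜 M.E)) : M.E →L[𝕜] 𝕜 :=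
  LinearMap.toContinuousLinearMap ((Module.finBasis 𝕜 M.E).coord k)

theorem sum_cov_smul (e : M.E) : ∑ k, M.cov k e • Module.finBasis 𝕜 M.E k = e :=
  (Module.finBasis 𝕜 M.E).sum_repr e

/-- Near `y`, the differential of `f` is a combination of the differentials of the coordinates,
with smooth coefficients. -/
theorem SmoothAt.exists_d_eq_sum (hf : M.SmoothAt f y) :
    ∃ c : Fin (Module.finrank 𝕜 M.E) → M.carrier → 𝕜, (∀ k, M.SmoothAt (c k) y) ∧
      ∀ᶠ z in 𝓝 y, M.d f z = ∑ k, c k z • M.d (M.coord y (M.cov k)) z := by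
  refine ⟨fun k => (fun p => fderiv 𝕜 (M.rep y f) p (Module.finBasis 𝕜 M.E k)) ∘ M.chart y,
    fun k => smoothAt_comp_chart ?_, ?_⟩
  · exact ((smoothAt_iff_rep.1 hf).fderiv_right (by simp)).clm_apply contDiffAt_const
  · filter_upwards [chart_source_mem, hf.eventually_d_eq] with z hz h
    ext v
    rw [h v]
    simp only [LinearMap.sum_apply, LinearMap.smul_apply, d_coord hz, Function.comp_apply]
    conv_lhs => rw [← sum_cov_smul (M.dchart y z v), map_sum]
    simp [mul_comm]

/-- Every covector is the differential of a coordinate function. -/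
theorem exists_coord_d_eq (α : M.T y →ₗ[𝕜] 𝕜) : ∃ ℓ, M.d (M.coord y ℓ) y = α := by
  have : FiniteDimensional 𝕜 (M.T y) := inferInstanceAs (FiniteDimensional 𝕜 M.E)
  refine ⟨LinearMap.toContinuousLinearMap (E := M.E) α, ?_⟩
  ext v
  rw [d_coord (mem_extChartAt_source y), dchart, mfderiv_extChartAt_self]
  rfl

theorem eq_of_d_eq {v v' : M.T y} (h : ∀ f, M.SmoothAt f y → M.d f y v = M.d f y v') :
    v = v' := by
  have : FiniteDimensional 𝕜 (M.T y) := inferInstanceAs (FiniteDimensional 𝕜 M.E)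
  rw [← sub_eq_zero, ← Module.forall_dual_apply_eq_zero_iff 𝕜]
  intro α
  obtain ⟨ℓ, rfl⟩ := exists_coord_d_eq α
  rw [map_sub, h _ (smoothAt_coord ℓ), sub_self]

/-! ### Vector fields smooth at a point -/

variable (M) in
/-- Vector fields that send functions smooth at `y` to functions smooth at `y`. -/
def VSmoothAt (X : M.VField) (y : M.carrier) : Prop :=
  ∀ f, M.SmoothAt f y → M.SmoothAt (M.deriv X f) y

/-- Near `y`, `df` is a combination of coordinate differentials with smooth coefficients, so it is
enough to test on coordinates. -/
theorem vSmoothAt_of_coord {X : M.VField}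
    (h : ∀ k, M.SmoothAt (M.deriv X (M.coord y (M.cov k))) y) : M.VSmoothAt X y := by
  intro f hf
  obtain ⟨c, hc, he⟩ := hf.exists_d_eq_sum
  refine (SmoothAt.sum Finset.univ fun k _ => (hc k).mul (h k)).congr ?_
  filter_upwards [he] with z hz
  simp [deriv, hz]

variable (M) in
/-- A vector field in the chart at `y`. -/
def vrep (y : M.carrier) (X : M.VField) : M.E → M.E :=
  fun p => M.dchart y ((M.chart y).symm p) (X ((M.chart y).symm p))

theorem VSmoothAt.contDiffAt_vrep {X : M.VField} (hX : M.VSmoothAt X y) :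
    ContDiffAt 𝕜 ∞ (M.vrep y X) (M.chart y y) := by
  have h : ∀ k, ContDiffAt 𝕜 ∞ (M.rep y (M.deriv X (M.coord y (M.cov k)))) (M.chart y y) :=
    fun k => smoothAt_iff_rep.1 (hX _ (smoothAt_coord _))
  have h' : ContDiffAt 𝕜 ∞ (fun p => ∑ k, M.rep y (M.deriv X (M.coord y (M.cov k))) p •
      Module.finBasis 𝕜 M.E k) (M.chart y y) :=
    ContDiffAt.sum fun k _ => (h k).smul contDiffAt_const
  refine h'.congr_of_eventuallyEq ?_
  filter_upwards [eventually_chart_target] with p hp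
  have hz := (M.chart y).map_target hp
  rw [← sum_cov_smul (M.vrep y X p)]
  refine Finset.sum_congr rfl fun k _ => ?_
  rw [rep, Function.comp_apply, deriv, d_coord hz, vrep]

theorem dchart_symm_eq_vrep {z : M.carrier} (hz : z ∈ (M.chart y).source) (X : M.VField) :
    M.vrep y X (M.chart y z) = M.dchart y z (X z) := by
  rw [vrep, (M.chart y).left_inv hz]

/-- In the trivialization at `y` the section is read through the differential of the chart, and its
components are the derivatives of the coordinate functions. From here on smoothness is handled
through derivations only. -/
theorem isSmoothVField_iff {X : M.VField} : M.IsSmoothVField X ↔ ∀ y, M.VSmoothAt X y := by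
  have key : ∀ y, ContMDiffAt 𝓘(𝕜, M.E) 𝓘(𝕜, M.E).tangent ∞
      (fun y => (⟨y, X y⟩ : TangentBundle 𝓘(𝕜, M.E) M.carrier)) y ↔
      ContMDiffAt 𝓘(𝕜, M.E) 𝓘(𝕜, M.E) ∞ (fun z => M.dchart y z (X z)) y := by
    intro y
    rw [Bundle.contMDiffAt_section]
    refine Filter.EventuallyEq.contMDiffAt_iff ?_
    filter_upwards [chart_source_mem] with z hz
    have hz' : z ∈ (chartAt M.E y).source := by rwa [← extChartAt_source (I := 𝓘(𝕜, M.E))]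
    rw [dchart, ← TangentBundle.continuousLinearMapAt_trivializationAt hz']
    rw [Bundle.Trivialization.continuousLinearMapAt_apply,
      Bundle.Trivialization.coe_linearMapAt_of_mem]
    simpa using hz'
  constructor
  · intro h y
    refine vSmoothAt_of_coord fun k => ?_
    have h1 := (key y).1 (h y)
    have h2 : ContMDiffAt 𝓘(𝕜, M.E) 𝓘(𝕜, 𝕜) ∞ (M.cov k ∘ fun z => M.dchart y z (X z)) y :=
      (M.cov k).contMDiff.contMDiffAt.comp y h1
    refine SmoothAt.congr h2 ?_
    filter_upwards [chart_source_mem] with z hz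
    rw [deriv, d_coord hz]; rfl
  · intro h y
    refine (key y).2 ?_
    have h1 : ContMDiffAt 𝓘(𝕜, M.E) 𝓘(𝕜, M.E) ∞ (M.vrep y X ∘ M.chart y) y :=
      ContMDiffAt.comp y (contMDiffAt_iff_contDiffAt.2 (h y).contDiffAt_vrep)
        contMDiffAt_extChartAt
    refine h1.congr_of_eventuallyEq ?_
    filter_upwards [chart_source_mem] with z hz
    exact (dchart_symm_eq_vrep hz X).symm

/-- The Lie bracket of vector fields is the commutator of derivations. -/
theorem d_mlieBracket {X Y : M.VField} (hX : M.VSmoothAt X y) (hY : M.VSmoothAt Y y)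
    (hf : M.SmoothAt f y) :
    M.d f y (VectorField.mlieBracket 𝓘(𝕜, M.E) X Y y) =
      M.deriv X (M.deriv Y f) y - M.deriv Y (M.deriv X f) y := by
  set F := M.rep y f with hF
  have hFs : ContDiffAt 𝕜 ∞ F (M.chart y y) := smoothAt_iff_rep.1 hf
  have hy : y ∈ (M.chart y).source := mem_extChartAt_source y
  have hdF : DifferentiableAt 𝕜 (fderiv 𝕜 F) (M.chart y y) :=
    (hFs.fderiv_right (m := 1) (WithTop.coe_le_coe.2
      (le_top (a := ((1 + 1 : ℕ) : ℕ∞))))).differentiableAt (by simp)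
  -- In the chart `X(Yf) = D²F(X, Y) + DF(DY · X)`.
  have second : ∀ {X Y : M.VField}, M.VSmoothAt X y → M.VSmoothAt Y y →
      M.deriv X (M.deriv Y f) y =
        fderiv 𝕜 (fderiv 𝕜 F) (M.chart y y) (M.vrep y X (M.chart y y)) (M.vrep y Y (M.chart y y))
        + fderiv 𝕜 F (M.chart y y)
          (fderiv 𝕜 (M.vrep y Y) (M.chart y y) (M.vrep y X (M.chart y y))) := by
    intro X Y hX hY
    have hYd := hY.contDiffAt_vrep.differentiableAt (by simp)
    have hev : M.rep y (M.deriv Y f) =ᶠ[𝓝 (M.chart y y)] fun p => fderiv 𝕜 F p (M.vrep y Y p) := by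
      filter_upwards [eventually_chart_target, tendsto_chart_symm.eventually hf.eventually_d_eq]
        with p hp h
      rw [rep, Function.comp_apply, deriv, h, (M.chart y).right_inv hp]; rfl
    rw [deriv, d_eq_fderiv_rep hy
      ((smoothAt_iff_rep.1 (hY f hf)).differentiableAt (by simp)), hev.fderiv_eq,
      fderiv_clm_apply hdF hYd, ← dchart_symm_eq_vrep hy X, add_comm]
    rfl
  -- The manifold bracket is defined by pulling back to the chart, where the pulled-back fields
  -- agree near the base point with the chart expressions.
  have hb : M.dchart y y (VectorField.mlieBracket 𝓘(𝕜, M.E) X Y y) =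
      VectorField.lieBracket 𝕜 (M.vrep y X) (M.vrep y Y) (M.chart y y) := by
    have hinv : (M.dchart y y).IsInvertible := isInvertible_mfderiv_extChartAt hy
    have hpull : ∀ X : M.VField,
        VectorField.mpullbackWithin 𝓘(𝕜, M.E) 𝓘(𝕜, M.E) (M.chart y).symm X (Set.range 𝓘(𝕜, M.E))
          =ᶠ[𝓝 (M.chart y y)] M.vrep y X := by
      intro X
      filter_upwards [eventually_chart_target] with p hp
      rw [VectorField.mpullbackWithin_apply, vrep, dchart]
      congr 1
      exact ContinuousLinearMap.inverse_eq
        (mfderivWithin_extChartAt_symm_comp_mfderiv_extChartAt hp)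
        (mfderiv_extChartAt_comp_mfderivWithin_extChartAt_symm hp)
    rw [← VectorField.mlieBracketWithin_univ, VectorField.mlieBracketWithin_apply]
    have h : ∀ e : M.E, M.dchart y y ((M.dchart y y).inverse e) = e := fun e =>
      (hinv.inverse_apply_eq.1 rfl).symm
    refine (h _).trans ?_
    simp only [modelWithCornersSelf_coe, Set.range_id, Set.preimage_univ,
      Set.inter_univ] at hpull ⊢
    refine (congrFun VectorField.lieBracketWithin_univ _).trans ?_
    exact (hpull X).lieBracket_vectorField_eq (hpull Y)
  -- Symmetry of the second derivative removes the `D²F` terms from the commutator.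
  have hsymm : IsSymmSndFDerivAt 𝕜 F (M.chart y y) := hFs.isSymmSndFDerivAt
    (by simpa using WithTop.coe_le_coe.2 (le_top (a := ((2 : ℕ) : ℕ∞))))
  rw [d_eq_fderiv_rep hy (hFs.differentiableAt (by simp)), hb, second hX hY, second hY hX,
    VectorField.lieBracket, hsymm.eq, map_sub]
  abel

end Mfd

end LocalAnalysis

/-! ### Bivector fields and their brackets evaluated on functions -/

section Bivectors

variable {𝕜 : Type w} [RCLike 𝕜] {M : Mfd.{w, u} 𝕜} {y : M.carrier}
  {f f' g h : M.carrier → 𝕜} {A B : M.TField} {X : M.VField}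

namespace Mfd

theorem SmoothAt.eventually_mdifferentiableAt (hf : M.SmoothAt f y) :
    ∀ᶠ z in 𝓝 y, MDifferentiableAt 𝓘(𝕜, M.E) 𝓘(𝕜, 𝕜) f z := by
  have h : ContMDiffAt 𝓘(𝕜, M.E) 𝓘(𝕜, 𝕜) 1 f y := ContMDiffAt.of_le hf (by simp)
  filter_upwards [(contMDiffAt_iff_contMDiffAt_nhds (by simp)).1 h] with z hz
    using hz.mdifferentiableAt (by simp)

theorem eventually_d_add (hf : M.SmoothAt f y) (hg : M.SmoothAt g y) :
    ∀ᶠ z in 𝓝 y, M.d (f + g) z = M.d f z + M.d g z := by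
  filter_upwards [hf.eventually_mdifferentiableAt, hg.eventually_mdifferentiableAt] with z h1 h2
  simp only [d, mvfderiv_add h1 h2]; rfl

theorem d_const_smul (c : 𝕜) (hf : M.SmoothAt f y) : M.d (c • f) y = c • M.d f y := by
  have h := d_mul (smoothAt_const c) hf
  rw [d_const, smul_zero, add_zero] at h
  exact h

theorem eval_eq_pairForm : M.eval A f g y = pairForm (A y) (M.d f y) (M.d g y) := rfl

theorem eval_add_tensor : M.eval (A + B) f g = M.eval A f g + M.eval B f g := by
  funext z; simp [eval]

theorem eval_congr_left {f' : M.carrier → 𝕜} (h : f =ᶠ[𝓝 y] f') :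
    M.eval A f g y = M.eval A f' g y := by rw [eval, d_congr h, eval]

theorem eval_congr_right {g' : M.carrier → 𝕜} (h : g =ᶠ[𝓝 y] g') :
    M.eval A f g y = M.eval A f g' y := by rw [eval, d_congr h, eval]

theorem eval_add_left (hf : M.SmoothAt f y) (hf' : M.SmoothAt f' y) :
    M.eval A (f + f') g y = M.eval A f g y + M.eval A f' g y := by
  simp only [eval_eq_pairForm, d_add hf hf', map_add, LinearMap.add_apply]

theorem eval_add_right (hf : M.SmoothAt f y) (hf' : M.SmoothAt f' y) :
    M.eval A g (f + f') y = M.eval A g f y + M.eval A g f' y := by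
  simp only [eval_eq_pairForm, d_add hf hf', map_add]

/-- The brackets differentiate `A(df, dg)` once more, so identities between such functions are
needed on a neighbourhood and not only at `y`. -/
theorem eventually_eval_add_left (hf : M.SmoothAt f y) (hf' : M.SmoothAt f' y) :
    M.eval A (f + f') g =ᶠ[𝓝 y] M.eval A f g + M.eval A f' g := by
  filter_upwards [eventually_d_add hf hf'] with z hz
  simp only [eval_eq_pairForm, hz, map_add, LinearMap.add_apply, Pi.add_apply]

theorem eventually_eval_add_right (hf : M.SmoothAt f y) (hf' : M.SmoothAt f' y) :
    M.eval A g (f + f') =ᶠ[𝓝 y] M.eval A g f + M.eval A g f' := by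
  filter_upwards [eventually_d_add hf hf'] with z hz
  simp only [eval_eq_pairForm, hz, map_add, Pi.add_apply]

theorem eventually_deriv_add (hf : M.SmoothAt f y) (hf' : M.SmoothAt f' y) :
    M.deriv X (f + f') =ᶠ[𝓝 y] M.deriv X f + M.deriv X f' := by
  filter_upwards [eventually_d_add hf hf'] with z hz
  simp only [deriv, hz, LinearMap.add_apply, Pi.add_apply]

theorem deriv_add (hf : M.SmoothAt f y) (hf' : M.SmoothAt f' y) :
    M.deriv X (f + f') y = M.deriv X f y + M.deriv X f' y :=
  (eventually_deriv_add hf hf').eq_of_nhds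

theorem deriv_congr {f' : M.carrier → 𝕜} (h : f =ᶠ[𝓝 y] f') :
    M.deriv X f y = M.deriv X f' y := by rw [deriv, d_congr h, deriv]

theorem deriv_neg : M.deriv X (-f) = -M.deriv X f := by
  funext z; simp [deriv, d_neg]

theorem eval_neg_right : M.eval A f (-g) = -M.eval A f g := by
  funext z; simp [eval_eq_pairForm, d_neg]

theorem eval_eq_zero_left (hf : M.d f y = 0) : M.eval A f g y = 0 := by
  simp [eval_eq_pairForm, hf]

theorem eval_eq_zero_right (hg : M.d g y = 0) : M.eval A f g y = 0 := by
  simp [eval_eq_pairForm, hg]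

theorem eval_swap (hA : ∀ z, flip (A z) = -A z) (f g : M.carrier → 𝕜) :
    M.eval A f g = -M.eval A g f := by
  funext z
  rw [Pi.neg_apply, eval, ← neg_eq_iff_eq_neg, ← pair₂_neg, ← hA, pair₂_flip, eval]

variable (M) in
/-- Tensor fields `A` for which `A(df, dg)` is smooth at `y` if `f` and `g` are. -/
def TSmoothAt (A : M.TField) (y : M.carrier) : Prop :=
  ∀ f g, M.SmoothAt f y → M.SmoothAt g y → M.SmoothAt (M.eval A f g) y

theorem IsBivector.tSmoothAt (hA : M.IsBivector A) (y : M.carrier) : M.TSmoothAt A y := hA.2 y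

theorem TSmoothAt.add (hA : M.TSmoothAt A y) (hB : M.TSmoothAt B y) : M.TSmoothAt (A + B) y := by
  intro f g hf hg
  rw [eval_add_tensor]
  exact (hA f g hf hg).add (hB f g hf hg)

theorem IsBivector.add (hA : M.IsBivector A) (hB : M.IsBivector B) : M.IsBivector (A + B) :=
  ⟨fun y => by rw [Pi.add_apply, flip_add, hA.1, hB.1]; exact (neg_add _ _).symm,
    fun y => (hA.tSmoothAt y).add (hB.tSmoothAt y)⟩

theorem isBivector_of_coord (hA : ∀ z, flip (A z) = -A z)
    (h : ∀ y k l, M.SmoothAt (M.eval A (M.coord y (M.cov k)) (M.coord y (M.cov l))) y) :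
    M.IsBivector A := by
  refine ⟨hA, fun y f g hf hg => ?_⟩
  obtain ⟨c, hc, he⟩ := hf.exists_d_eq_sum
  obtain ⟨c', hc', he'⟩ := hg.exists_d_eq_sum
  refine (SmoothAt.sum Finset.univ fun k _ => SmoothAt.sum Finset.univ fun l _ =>
    ((hc k).mul (hc' l)).mul (h y k l)).congr ?_
  filter_upwards [he, he'] with z hz hz'
  simp only [eval_eq_pairForm, hz, hz', map_sum, LinearMap.sum_apply, map_smul,
    LinearMap.smul_apply, smul_eq_mul, Pi.mul_apply, Finset.mul_sum]
  rw [Finset.sum_comm]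
  refine Finset.sum_congr rfl fun k _ => Finset.sum_congr rfl fun l _ => ?_
  ring

/-! ### Bilinearity and tensoriality of the brackets -/

theorem lieD_add_tensor (hA : M.TSmoothAt A y) (hB : M.TSmoothAt B y)
    (hf : M.SmoothAt f y) (hg : M.SmoothAt g y) :
    M.lieD X (A + B) f g y = M.lieD X A f g y + M.lieD X B f g y := by
  simp only [lieD, eval_add_tensor, Pi.sub_apply, Pi.add_apply,
    deriv_add (hA f g hf hg) (hB f g hf hg)]
  ring

/-- The expression defining the bracket is bilinear and symmetric in the two tensors, hence the
factor `2`. -/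
theorem schouten_add_tensor (hA : M.TSmoothAt A y) (hB : M.TSmoothAt B y)
    (hf : M.SmoothAt f y) (hg : M.SmoothAt g y) (hh : M.SmoothAt h y) :
    M.schouten (A + B) (A + B) f g h y =
      M.schouten A A f g h y + 2 * M.schouten A B f g h y + M.schouten B B f g h y := by
  simp only [schouten, eval_add_tensor, Pi.add_apply,
    eval_add_right (hA g h hg hh) (hB g h hg hh), eval_add_right (hA h f hh hf) (hB h f hh hf),
    eval_add_right (hA f g hf hg) (hB f g hf hg)]
  ring

theorem schouten_rotate : M.schouten A B f g h = M.schouten A B g h f := by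
  simp only [schouten]; abel

theorem lieD_swap (hA : ∀ z, flip (A z) = -A z) : M.lieD X A f g = -M.lieD X A g f := by
  simp only [lieD]
  rw [eval_swap hA f g, eval_swap hA (M.deriv X f) g, eval_swap hA f (M.deriv X g), deriv_neg]
  abel

theorem lieD_add_left (hX : M.VSmoothAt X y) (hA : M.TSmoothAt A y)
    (hf : M.SmoothAt f y) (hf' : M.SmoothAt f' y) (hg : M.SmoothAt g y) :
    M.lieD X A (f + f') g y = M.lieD X A f g y + M.lieD X A f' g y := by
  simp only [lieD, Pi.sub_apply]
  rw [deriv_congr (eventually_eval_add_left hf hf'), deriv_add (hA f g hf hg) (hA f' g hf' hg),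
    eval_congr_left (eventually_deriv_add hf hf'), eval_add_left (hX f hf) (hX f' hf'),
    eval_add_left hf hf']
  ring

theorem schouten_add_left (hA : M.TSmoothAt A y)
    (hf : M.SmoothAt f y) (hf' : M.SmoothAt f' y) (hg : M.SmoothAt g y) (hh : M.SmoothAt h y) :
    M.schouten A A (f + f') g h y = M.schouten A A f g h y + M.schouten A A f' g h y := by
  simp only [schouten, Pi.add_apply]
  rw [eval_add_left hf hf', eval_congr_right (eventually_eval_add_right hf hf'),
    eval_congr_right (eventually_eval_add_left hf hf'),
    eval_add_right (hA h f hh hf) (hA h f' hh hf'), eval_add_right (hA f g hf hg) (hA f' g hf' hg)]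
  ring

variable (M) in
/-- The hamiltonian vector field `A(·, dg)`. -/
def ham (A : M.TField) (g : M.carrier → 𝕜) : M.VField :=
  fun z => TensorProduct.rid 𝕜 (M.T z) (LinearMap.lTensor (M.T z) (M.d g z) (A z))

theorem deriv_ham : M.deriv (M.ham A g) f = M.eval A f g := by
  funext z
  simp only [deriv, ham, eval]
  induction A z with
  | zero => simp
  | add t t' h h' => simp only [map_add, pair₂_add, h, h']
  | tmul a b => simp [mul_comm]

theorem TSmoothAt.vSmoothAt_ham (hA : M.TSmoothAt A y) (hg : M.SmoothAt g y) :
    M.VSmoothAt (M.ham A g) y := fun f hf => by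
  rw [deriv_ham]; exact hA f g hf hg

/-- The commutator is again a vector field, so it kills `f` wherever `df = 0`. This is the source of
the tensoriality of both brackets. -/
theorem deriv_comm_of_d_eq_zero {X X' : M.VField} (hX : M.VSmoothAt X y) (hX' : M.VSmoothAt X' y)
    (hf : M.SmoothAt f y) (h0 : M.d f y = 0) :
    M.deriv X (M.deriv X' f) y = M.deriv X' (M.deriv X f) y := by
  rw [← sub_eq_zero, ← d_mlieBracket hX hX' hf, h0, LinearMap.zero_apply]

/-- The second-order part in `f` is the commutator of `X` with the hamiltonian field of `g`, applied
to `f`. -/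
theorem lieD_eq_zero (hX : M.VSmoothAt X y) (hA : M.TSmoothAt A y)
    (hf : M.SmoothAt f y) (hg : M.SmoothAt g y) (h0 : M.d f y = 0) : M.lieD X A f g y = 0 := by
  simp only [lieD, Pi.sub_apply]
  rw [eval_eq_zero_left h0, sub_zero, ← deriv_ham, ← deriv_ham,
    deriv_comm_of_d_eq_zero hX (hA.vSmoothAt_ham hg) hf h0, sub_self]

/-- By skewness, the terms in which `f` is differentiated twice combine to the commutator of the
hamiltonian fields of `g` and `h`, applied to `f`. Cyclic rotation gives the same for the other
arguments. -/
theorem schouten_eq_zero (hA : M.IsBivector A)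
    (hf : M.SmoothAt f y) (hg : M.SmoothAt g y) (hh : M.SmoothAt h y) (h0 : M.d f y = 0) :
    M.schouten A A f g h y = 0 := by
  have hT := hA.tSmoothAt y
  have e1 : M.eval A g (M.eval A h f) = M.deriv (M.ham A g) (M.deriv (M.ham A h) f) := by
    rw [deriv_ham, deriv_ham, eval_swap hA.1 h f, eval_neg_right, eval_swap hA.1 g, neg_neg]
  have e2 : M.eval A h (M.eval A f g) = -M.deriv (M.ham A h) (M.deriv (M.ham A g) f) := by
    rw [deriv_ham, deriv_ham, eval_swap hA.1 h]
  simp only [schouten, Pi.add_apply]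
  rw [eval_eq_zero_left h0, e1, e2, Pi.neg_apply,
    deriv_comm_of_d_eq_zero (hT.vSmoothAt_ham hg) (hT.vSmoothAt_ham hh) hf h0]
  ring

end Mfd

end Bivectors

/-! ### Actions, twisting and restriction -/

section Actions

variable {𝕜 : Type w} [RCLike 𝕜] {L : Type v} [LieRing L] [LieAlgebra 𝕜 L]
  {Y : PreSpace.{w, v, u} 𝕜 L} {y : Y.M.carrier} {f g h : Y.M.carrier → 𝕜}

namespace PreSpace

open Mfd

theorem IsLeftAction.vSmoothAt (hY : Y.IsLeftAction) (x : L) (y : Y.M.carrier) :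
    Y.M.VSmoothAt (Y.act x) y := isSmoothVField_iff.1 (hY.1 x) y

theorem IsLeftAction.deriv_comm (hY : Y.IsLeftAction) (x x' : L) (hf : Y.M.SmoothAt f y) :
    Y.M.deriv (Y.act x) (Y.M.deriv (Y.act x') f) y -
      Y.M.deriv (Y.act x') (Y.M.deriv (Y.act x) f) y = -Y.M.deriv (Y.act ⁅x, x'⁆) f y := by
  rw [← d_mlieBracket (hY.vSmoothAt x y) (hY.vSmoothAt x' y) hf, Mfd.deriv, hY.2]
  simp

/-- The pull-back of a differential to the Lie algebra. -/
def dAct (Y : PreSpace.{w, v, u} 𝕜 L) (f : Y.M.carrier → 𝕜) (y : Y.M.carrier) : L →ₗ[𝕜] 𝕜 :=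
  Y.M.d f y ∘ₗ Y.actAt y

theorem dAct_apply (x : L) : Y.dAct f y x = Y.M.deriv (Y.act x) f y := rfl

theorem eval_act₂ (t : L ⊗[𝕜] L) :
    Y.M.eval (Y.act₂ t) f g y = pair₂ t (Y.dAct f y) (Y.dAct g y) := pair₂_map _ _ _ _

theorem eval_act₂_tmul (a b : L) :
    Y.M.eval (Y.act₂ (a ⊗ₜ b)) f g = Y.M.deriv (Y.act a) f * Y.M.deriv (Y.act b) g := by
  funext z
  rw [eval_act₂, pair₂_tmul]; rfl

theorem act₂_add (t t' : L ⊗[𝕜] L) : Y.act₂ (t + t') = Y.act₂ t + Y.act₂ t' := by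
  funext z; simp [act₂]

theorem act₂_zero : Y.act₂ (0 : L ⊗[𝕜] L) = 0 := by
  funext z; simp [act₂]

theorem IsLeftAction.tSmoothAt_act₂ (hY : Y.IsLeftAction) (t : L ⊗[𝕜] L) (y : Y.M.carrier) :
    Y.M.TSmoothAt (Y.act₂ t) y := by
  induction t with
  | zero =>
    intro f g _ _
    have : Y.M.eval (Y.act₂ 0) f g = fun _ => 0 := by funext z; simp [eval_act₂]
    rw [this]; exact smoothAt_const 0
  | add t t' h h' => rw [act₂_add]; exact h.add h'
  | tmul a b =>
    intro f g hf hg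
    rw [eval_act₂_tmul]
    exact (hY.vSmoothAt a y f hf).mul (hY.vSmoothAt b y g hg)

theorem IsLeftAction.isBivector_act₂ (hY : Y.IsLeftAction) {t : L ⊗[𝕜] L} (ht : flip t = -t) :
    Y.M.IsBivector (Y.act₂ t) := by
  refine ⟨fun z => ?_, hY.tSmoothAt_act₂ t⟩
  rw [act₂, flip_map, ht, map_neg]

/-- The Leibniz rule on each tensor factor; the sign is that of an anti-homomorphism. -/
theorem IsLeftAction.lieD_act₂ (hY : Y.IsLeftAction) (x : L) (t : L ⊗[𝕜] L)
    (hf : Y.M.SmoothAt f y) (hg : Y.M.SmoothAt g y) :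
    Y.M.lieD (Y.act x) (Y.act₂ t) f g y = -Y.M.eval (Y.act₂ ⁅x, t⁆) f g y := by
  induction t with
  | zero =>
    have h0 : ∀ f g, Y.M.eval (Y.act₂ 0) f g = 0 := fun f g => by
      funext z; simp [eval_act₂]
    simp [Mfd.lieD, h0, Mfd.deriv, d_zero]
  | add t t' h h' =>
    rw [act₂_add, lieD_add_tensor (hY.tSmoothAt_act₂ t y) (hY.tSmoothAt_act₂ t' y) hf hg, h, h',
      lie_add, act₂_add, eval_add_tensor, Pi.add_apply, neg_add]
  | tmul a b =>
    have ha := hY.deriv_comm x a hf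
    have hb := hY.deriv_comm x b hg
    simp only [Mfd.lieD, Pi.sub_apply, eval_act₂_tmul, TensorProduct.LieModule.lie_tmul_right,
      act₂_add, eval_add_tensor, Pi.add_apply, Pi.mul_apply]
    have hm : Y.M.deriv (Y.act x) (Y.M.deriv (Y.act a) f * Y.M.deriv (Y.act b) g) y =
        Y.M.deriv (Y.act a) f y * Y.M.deriv (Y.act x) (Y.M.deriv (Y.act b) g) y +
        Y.M.deriv (Y.act b) g y * Y.M.deriv (Y.act x) (Y.M.deriv (Y.act a) f) y := by
      rw [Mfd.deriv, d_mul (hY.vSmoothAt a y f hf) (hY.vSmoothAt b y g hg)]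
      rfl
    rw [hm]
    linear_combination Y.M.deriv (Y.act b) g y * ha + Y.M.deriv (Y.act a) f y * hb

/-- Regarding `x ↦ A(df, d(λ(x)g))` as a covector on `L` lets the terms of a Schouten bracket with
`λ(t)` be written as pairings with `t`, without decomposing `t`. -/
theorem IsLeftAction.exists_linear_eval (hY : Y.IsLeftAction) (A : Y.M.TField)
    (f : Y.M.carrier → 𝕜) (hg : Y.M.SmoothAt g y) :
    ∃ k : L →ₗ[𝕜] 𝕜, ∀ x, k x = Y.M.eval A f (Y.M.deriv (Y.act x) g) y := by
  refine ⟨{ toFun := fun x => Y.M.eval A f (Y.M.deriv (Y.act x) g) y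
            map_add' := fun x x' => ?_
            map_smul' := fun c x => ?_ }, fun x => rfl⟩
  · have : Y.M.deriv (Y.act (x + x')) g = Y.M.deriv (Y.act x) g + Y.M.deriv (Y.act x') g := by
      funext z; simp [Mfd.deriv]
    rw [this, eval_add_right (hY.vSmoothAt x y g hg) (hY.vSmoothAt x' y g hg)]
  · have : Y.M.deriv (Y.act (c • x)) g = c • Y.M.deriv (Y.act x) g := by
      funext z; simp [Mfd.deriv]
    rw [this, eval_eq_pairForm, d_const_smul c (hY.vSmoothAt x y g hg), map_smul]
    rfl

theorem IsLeftAction.eval_eval_act₂ (hY : Y.IsLeftAction) (A : Y.M.TField)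
    (hg : Y.M.SmoothAt g y) (hh : Y.M.SmoothAt h y) {kg kh : L →ₗ[𝕜] 𝕜}
    (hkg : ∀ x, kg x = Y.M.eval A f (Y.M.deriv (Y.act x) g) y)
    (hkh : ∀ x, kh x = Y.M.eval A f (Y.M.deriv (Y.act x) h) y) (t : L ⊗[𝕜] L) :
    Y.M.eval A f (Y.M.eval (Y.act₂ t) g h) y =
      pair₂ t kg (Y.dAct h y) + pair₂ t (Y.dAct g y) kh := by
  induction t with
  | zero =>
    have h0 : Y.M.eval (Y.act₂ 0) g h = 0 := by funext z; simp [eval_act₂]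
    simp [h0, eval_eq_zero_right d_zero]
  | add t t' h1 h2 =>
    rw [act₂_add, eval_add_tensor, eval_add_right (hY.tSmoothAt_act₂ t y g h hg hh)
      (hY.tSmoothAt_act₂ t' y g h hg hh), h1, h2, pair₂_add, pair₂_add]
    ring
  | tmul a b =>
    rw [eval_act₂_tmul, eval_eq_pairForm, d_mul (hY.vSmoothAt a y g hg) (hY.vSmoothAt b y h hh),
      pair₂_tmul, pair₂_tmul, hkg, hkh, map_add, map_smul, map_smul, dAct_apply, dAct_apply]
    simp only [eval_eq_pairForm, smul_eq_mul]
    ring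

theorem pair₃_lTensor (κ : L →ₗ[𝕜] L ⊗[𝕜] L) (t : L ⊗[𝕜] L) (α β γ k : L →ₗ[𝕜] 𝕜)
    (hk : ∀ x, k x = pair₂ (κ x) β γ) :
    pair₃ (LinearMap.lTensor L κ t) α β γ = pair₂ t α k := by
  induction t with
  | zero => simp
  | add t t' h h' => simp only [map_add, pair₃_add, pair₂_add, h, h']
  | tmul a b =>
    rw [LinearMap.lTensor_tmul, pair₂_tmul, hk]
    induction κ b with
    | zero => simp
    | add u u' h h' => simp only [TensorProduct.tmul_add, pair₃_add, pair₂_add, h, h', mul_add]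
    | tmul c d => simp

/-- The Schouten bracket of a bi-vector field `A` with `λ(t)`, when `[λ(x), A] = λ(κ(x))`. -/
theorem IsLeftAction.schouten_act₂ (hY : Y.IsLeftAction) {A : Y.M.TField}
    (hA : Y.M.IsBivector A) {κ : L →ₗ[𝕜] L ⊗[𝕜] L}
    (hκ : ∀ (x : L) (f g : Y.M.carrier → 𝕜), Y.M.SmoothAt f y → Y.M.SmoothAt g y →
      Y.M.lieD (Y.act x) A f g y = Y.M.eval (Y.act₂ (κ x)) f g y)
    {t : L ⊗[𝕜] L} (ht : flip t = -t)
    (hf : Y.M.SmoothAt f y) (hg : Y.M.SmoothAt g y) (hh : Y.M.SmoothAt h y) :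
    Y.M.schouten A (Y.act₂ t) f g h y =
      pair₃ (LinearMap.lTensor L κ t) (Y.dAct f y) (Y.dAct g y) (Y.dAct h y)
      + pair₃ (LinearMap.lTensor L κ t) (Y.dAct g y) (Y.dAct h y) (Y.dAct f y)
      + pair₃ (LinearMap.lTensor L κ t) (Y.dAct h y) (Y.dAct f y) (Y.dAct g y) := by
  obtain ⟨kfg, hfg⟩ := hY.exists_linear_eval A f hg
  obtain ⟨kfh, hfh⟩ := hY.exists_linear_eval A f hh
  obtain ⟨kgf, hgf⟩ := hY.exists_linear_eval A g hf
  obtain ⟨kgh, hgh⟩ := hY.exists_linear_eval A g hh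
  obtain ⟨khf, hhf⟩ := hY.exists_linear_eval A h hf
  obtain ⟨khg, hhg⟩ := hY.exists_linear_eval A h hg
  have skew : ∀ α β : L →ₗ[𝕜] 𝕜, pair₂ t α β = -pair₂ t β α := fun α β => by
    rw [← pair₂_flip, ht, pair₂_neg]
  -- Differentiating `A(g, h)` along `λ(x)` gives `λ(κ(x))(g, h) + A(λ(x)g, h) + A(g, λ(x)h)`. The
  -- last two terms are the corrections `-khg + kgh`.
  have outer : ∀ {f g h : Y.M.carrier → 𝕜} {kgh khg : L →ₗ[𝕜] 𝕜},
      Y.M.SmoothAt g y → Y.M.SmoothAt h y →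
      (∀ x, kgh x = Y.M.eval A g (Y.M.deriv (Y.act x) h) y) →
      (∀ x, khg x = Y.M.eval A h (Y.M.deriv (Y.act x) g) y) →
      Y.M.eval (Y.act₂ t) f (Y.M.eval A g h) y =
        pair₃ (LinearMap.lTensor L κ t) (Y.dAct f y) (Y.dAct g y) (Y.dAct h y)
        - pair₂ t (Y.dAct f y) khg + pair₂ t (Y.dAct f y) kgh := by
    intro f g h kgh khg hg hh hgh hhg
    rw [eval_act₂, pair₃_lTensor κ t _ _ _ (Y.dAct (Y.M.eval A g h) y + khg - kgh)]
    · simp only [← pairForm_apply, map_add, map_sub]; ring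
    · intro x
      rw [← eval_act₂, ← hκ x g h hg hh, LinearMap.sub_apply, LinearMap.add_apply, hgh, hhg,
        dAct_apply, Mfd.lieD, Pi.sub_apply, Pi.sub_apply,
        eval_swap hA.1 (Y.M.deriv (Y.act x) g) h, Pi.neg_apply]
      ring
  -- Over the cyclic sum, the corrections cancel against the Leibniz terms of `A(f, λ(t)(g, h))` by
  -- skewness of `t`, leaving only the terms in `κ`.
  simp only [Mfd.schouten, Pi.add_apply]
  rw [hY.eval_eval_act₂ A hg hh hfg hfh, hY.eval_eval_act₂ A hh hf hgh hgf,
    hY.eval_eval_act₂ A hf hg hhf hhg, outer hg hh hgh hhg, outer hh hf hhf hfh,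
    outer hf hg hfg hgf, skew kfg, skew kgh, skew khf]
  ring

/-! ### Twisting -/

theorem lTensor_coBracket_skewPart {r : L ⊗[𝕜] L} (hr : IsQuasitriangular r) :
    coBracket (skewPart r) = coBracket r := by
  ext x; exact lie_skewPart r hr.1 x

theorem IsPoissonSpace.twist {r : L ⊗[𝕜] L} (hr : IsQuasitriangular r)
    (hY : Y.IsPoissonSpace (coBracket r)) :
    ((PreSpace.twist (skewPart r)).obj Y).IsQuasiPoissonSpace (phi (symPart r)) := by
  have hl := hY.isLeftAction
  have hb := hl.isBivector_act₂ (flip_skewPart r)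
  refine ⟨hl, hY.isBivector.add hb, ?_, ?_⟩
  · intro x (y : Y.M.carrier) (f : Y.M.carrier → 𝕜) (g : Y.M.carrier → 𝕜)
      (hf : Y.M.SmoothAt f y) (hg : Y.M.SmoothAt g y)
    change Y.M.lieD (Y.act x) (Y.tensor + Y.act₂ (skewPart r)) f g y = 0
    rw [lieD_add_tensor (hY.isBivector.tSmoothAt y) (hb.tSmoothAt y) hf hg,
      hY.poissonAction x y f g hf hg, hl.lieD_act₂ x _ hf hg, lie_skewPart r hr.1]
    exact add_neg_cancel _
  · intro (y : Y.M.carrier) (f : Y.M.carrier → 𝕜) (g : Y.M.carrier → 𝕜) (h : Y.M.carrier → 𝕜)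
      (hf : Y.M.SmoothAt f y) (hg : Y.M.SmoothAt g y) (hh : Y.M.SmoothAt h y)
    change Y.M.schouten (Y.tensor + Y.act₂ (skewPart r)) (Y.tensor + Y.act₂ (skewPart r)) f g h y =
      pair₃ (map₃ (Y.actAt y) (phi (symPart r))) (Y.M.d f y) (Y.M.d g y) (Y.M.d h y)
    -- With `C` the cyclic sum of `∑ a ⊗ ad_b Λ`, here `[π, λ(Λ)] = λ(C)`, and `h2` gives `[λ(Λ),
    -- λ(Λ)] = -λ(C)`. The total `0 + 2C - C` is `2 CYB(Λ) = φ_s`.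
    have h1 := hl.schouten_act₂ hY.isBivector (fun x f g => hY.poissonAction x y f g)
      (flip_skewPart r) hf hg hh
    have h2 := hl.schouten_act₂ (y := y) (κ := -coBracket (skewPart r)) hb
      (fun x f g hf hg => by
        rw [hl.lieD_act₂ x _ hf hg, eval_act₂, eval_act₂, ← pair₂_neg]; rfl)
      (flip_skewPart r) hf hg hh
    have h3 := cyclic_lTensor_coBracket (flip_skewPart r) (Y.dAct f y) (Y.dAct g y) (Y.dAct h y)
    rw [schouten_add_tensor (hY.isBivector.tSmoothAt y) (hb.tSmoothAt y) hf hg hh,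
      hY.poisson y f g h hf hg hh, h1, h2, pair₃_map₃, ← hr.two_smul_cyb_skewPart]
    simp only [LinearMap.lTensor_neg, LinearMap.neg_apply, pair₃_neg]
    rw [lTensor_coBracket_skewPart hr] at h3 ⊢
    refine Eq.trans ?_ h3
    ring

theorem IsQuasiPoissonSpace.twist {r : L ⊗[𝕜] L} (hr : IsQuasitriangular r)
    (hY : Y.IsQuasiPoissonSpace (phi (symPart r))) :
    ((PreSpace.twist (-skewPart r)).obj Y).IsPoissonSpace (coBracket r) := by
  have hl := hY.isLeftAction
  have hs : flip (-skewPart r) = -(-skewPart r) := by rw [flip_neg, flip_skewPart]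
  have hb := hl.isBivector_act₂ hs
  refine ⟨hl, hY.isBivector.add hb, ?_, ?_⟩
  · intro (y : Y.M.carrier) (f : Y.M.carrier → 𝕜) (g : Y.M.carrier → 𝕜) (h : Y.M.carrier → 𝕜)
      (hf : Y.M.SmoothAt f y) (hg : Y.M.SmoothAt g y) (hh : Y.M.SmoothAt h y)
    change Y.M.schouten (Y.tensor + Y.act₂ (-skewPart r)) (Y.tensor + Y.act₂ (-skewPart r))
      f g h y = 0
    -- Invariance of `Q` means `κ = 0`, so the cross term vanishes, and `[λ(Λ), λ(Λ)] = -λ(φ_s)`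
    -- cancels `[Q, Q]`.
    have h1 := hl.schouten_act₂ (y := y) (κ := 0) hY.isBivector (fun x f g hf hg => by
        rw [hY.invariant x y f g hf hg, eval_act₂, LinearMap.zero_apply, pair₂_zero]) hs hf hg hh
    have h2 := hl.schouten_act₂ (y := y) (κ := coBracket (skewPart r)) hb
      (fun x f g hf hg => by
        rw [hl.lieD_act₂ x _ hf hg, eval_act₂, eval_act₂, ← pair₂_neg, lie_neg, neg_neg]; rfl)
      hs hf hg hh
    have h3 := cyclic_lTensor_coBracket (flip_skewPart r) (Y.dAct f y) (Y.dAct g y) (Y.dAct h y)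
    have h4 := hY.quasiPoisson y f g h hf hg hh
    rw [pair₃_map₃, ← hr.two_smul_cyb_skewPart] at h4
    rw [schouten_add_tensor (hY.isBivector.tSmoothAt y) (hb.tSmoothAt y) hf hg hh, h4, h1, h2]
    simp only [map_neg, pair₃_neg, LinearMap.lTensor_zero, LinearMap.zero_apply, pair₃_zero]
    refine (congrArg₂ (· + ·) (congrArg₂ (· + ·) h3.symm rfl) rfl).trans ?_
    ring
  · intro x (y : Y.M.carrier) (f : Y.M.carrier → 𝕜) (g : Y.M.carrier → 𝕜)
      (hf : Y.M.SmoothAt f y) (hg : Y.M.SmoothAt g y)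
    change Y.M.lieD (Y.act x) (Y.tensor + Y.act₂ (-skewPart r)) f g y =
      Y.M.eval (Y.act₂ (coBracket r x)) f g y
    rw [lieD_add_tensor (hY.isBivector.tSmoothAt y) (hb.tSmoothAt y) hf hg,
      hY.invariant x y f g hf hg, hl.lieD_act₂ x _ hf hg, lie_neg, lie_skewPart r hr.1, zero_add,
      eval_act₂, eval_act₂, pair₂_neg, neg_neg]
    rfl

/-! ### Restriction -/

theorem IsPoissonSpace.restrict {L' : Type v} [LieRing L'] [LieAlgebra 𝕜 L'] (φ : L' →ₗ[𝕜] L)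
    (hφ : ∀ x x', φ ⁅x, x'⁆ = ⁅φ x, φ x'⁆) {δ : L →ₗ[𝕜] L ⊗[𝕜] L} {δ' : L' →ₗ[𝕜] L' ⊗[𝕜] L'}
    (hδ : ∀ x, δ (φ x) = TensorProduct.map φ φ (δ' x)) (hY : Y.IsPoissonSpace δ) :
    ((PreSpace.restrict φ).obj Y).IsPoissonSpace δ' := by
  refine ⟨⟨fun x => hY.isLeftAction.1 (φ x), fun x x' => ?_⟩, hY.isBivector, hY.poisson, ?_⟩
  · change Y.act (φ ⁅x, x'⁆) = _
    rw [hφ, hY.isLeftAction.2]; rfl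
  · intro x (y : Y.M.carrier) (f : Y.M.carrier → 𝕜) (g : Y.M.carrier → 𝕜)
      (hf : Y.M.SmoothAt f y) (hg : Y.M.SmoothAt g y)
    refine (hY.poissonAction (φ x) y f g hf hg).trans ?_
    rw [hδ, eval_act₂, pair₂_map]
    exact (eval_act₂ (Y := (PreSpace.restrict φ).obj Y) _).symm

end PreSpace

end Actions

/-! ### Functions on a product manifold -/

section Products

variable {𝕜 : Type w} [RCLike 𝕜] {n : ℕ}

namespace Mfd

variable {M : Fin n → Mfd.{w, u} 𝕜} {y : (Mfd.pi M).carrier}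

/-- The pull-back of a function on a factor to the product. -/
def pull (M : Fin n → Mfd.{w, u} 𝕜) (i : Fin n) (f : (M i).carrier → 𝕜) :
    (Mfd.pi M).carrier → 𝕜 := fun y => f (y i)

theorem continuous_proj (i : Fin n) :
    Continuous (fun y : (Mfd.pi M).carrier => (y i : (M i).carrier)) :=
  continuous_apply (A := fun i => (M i).carrier) i

theorem tendsto_proj (i : Fin n) :
    Tendsto (fun y : (Mfd.pi M).carrier => (y i : (M i).carrier)) (𝓝 y) (𝓝 (y i)) :=
  (continuous_proj i).tendsto y

/-- The chart of the product is the product of the charts, so a projection reads as a linear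
projection; its smoothness and its differential both follow. -/
theorem written_proj (i : Fin n) :
    ((M i).chart (y i) ∘ (fun y : (Mfd.pi M).carrier => (y i : (M i).carrier)) ∘
      ((Mfd.pi M).chart y).symm) =ᶠ[𝓝 ((Mfd.pi M).chart y y)]
      ContinuousLinearMap.proj (R := 𝕜) (φ := fun i => (M i).E) i := by
  filter_upwards [eventually_chart_target] with p hp
  have h := ((Mfd.pi M).chart y).right_inv hp
  exact congrFun h i

theorem contMDiffAt_proj (i : Fin n) :
    ContMDiffAt 𝓘(𝕜, (Mfd.pi M).E) 𝓘(𝕜, (M i).E) ∞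
      (fun y : (Mfd.pi M).carrier => (y i : (M i).carrier)) y := by
  rw [contMDiffAt_iff]
  refine ⟨(continuous_proj i).continuousAt, ?_⟩
  simp only [modelWithCornersSelf_coe, Set.range_id, contDiffWithinAt_univ]
  exact (ContinuousLinearMap.contDiff (ContinuousLinearMap.proj (R := 𝕜) (φ := fun i => (M i).E)
    i)).contDiffAt.congr_of_eventuallyEq (written_proj i)

theorem hasMFDerivAt_proj (i : Fin n) :
    HasMFDerivAt 𝓘(𝕜, (Mfd.pi M).E) 𝓘(𝕜, (M i).E)
      (fun y : (Mfd.pi M).carrier => (y i : (M i).carrier)) y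
      (ContinuousLinearMap.proj (R := 𝕜) (φ := fun i => (M i).E) i) := by
  refine ⟨(continuous_proj i).continuousAt, ?_⟩
  simp only [modelWithCornersSelf_coe, Set.range_id]
  exact ((ContinuousLinearMap.hasFDerivAt (ContinuousLinearMap.proj (R := 𝕜)
    (φ := fun i => (M i).E) i)).congr_of_eventuallyEq (written_proj i)).hasFDerivWithinAt

theorem SmoothAt.pull {i : Fin n} {f : (M i).carrier → 𝕜} (hf : (M i).SmoothAt f (y i)) :
    (Mfd.pi M).SmoothAt (Mfd.pull M i f) y :=
  ContMDiffAt.comp (g := f) y hf (contMDiffAt_proj i)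

theorem d_pull {i : Fin n} {f : (M i).carrier → 𝕜}
    (hf : MDifferentiableAt 𝓘(𝕜, (M i).E) 𝓘(𝕜, 𝕜) f (y i)) :
    (Mfd.pi M).d (pull M i f) y =
      (M i).d f (y i) ∘ₗ LinearMap.proj (R := 𝕜) (φ := fun i => (M i).E) i := by
  have h := (HasMFDerivAt.comp (g := f) y hf.hasMFDerivAt (hasMFDerivAt_proj i)).mfderiv
  refine LinearMap.ext fun v => ?_
  exact congrArg (fun A : (∀ i, (M i).E) →L[𝕜] 𝕜 => A v) h

theorem eventually_d_pull {i : Fin n} {f : (M i).carrier → 𝕜} (hf : (M i).SmoothAt f (y i)) :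
    ∀ᶠ z in 𝓝 y, (Mfd.pi M).d (pull M i f) z =
      (M i).d f (z i) ∘ₗ LinearMap.proj (R := 𝕜) (φ := fun i => (M i).E) i := by
  filter_upwards [(tendsto_proj i).eventually hf.eventually_mdifferentiableAt] with z hz
    using d_pull hz

/-- A linear form on a product is a sum of linear forms on the factors. Since every covector is the
differential of such a coordinate function, tensorial identities reduce to pull-backs. -/
theorem coord_pi (ℓ : (Mfd.pi M).E →L[𝕜] 𝕜) :
    (Mfd.pi M).coord y ℓ = fun z => ∑ i, pull M i ((M i).coord (y i)
      (ℓ ∘L ContinuousLinearMap.single 𝕜 (fun i => (M i).E) i)) z := by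
  funext z
  have h : (Mfd.pi M).chart y z = ∑ i, Pi.single (M := fun i => (M i).E) i
      ((M i).chart (y i) (z i)) := (Finset.univ_sum_single ((Mfd.pi M).chart y z)).symm
  exact (congrArg ℓ h).trans (map_sum ℓ _ _)

theorem eventually_d_sum {N : Mfd.{w, u} 𝕜} {y : N.carrier} {ι : Type*} (s : Finset ι)
    {F : ι → N.carrier → 𝕜} (hF : ∀ i ∈ s, N.SmoothAt (F i) y) :
    ∀ᶠ z in 𝓝 y, N.d (fun z => ∑ i ∈ s, F i z) z = ∑ i ∈ s, N.d (F i) z := by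
  classical
  induction s using Finset.induction_on with
  | empty => exact .of_forall fun z => by simpa using d_const 0
  | insert i s hi ih =>
    have hs : ∀ j ∈ s, N.SmoothAt (F j) y := fun j hj => hF j (by simp [hj])
    filter_upwards [ih hs, eventually_d_add (hF i (by simp)) (SmoothAt.sum s hs)] with z h1 h2
    simp only [Finset.sum_insert hi]
    rw [← h1, ← h2]; rfl

/-- A condition on the differential of a function at a point of a product can be verified on the
pull-backs of functions on the factors. -/
theorem pi_induction {D : ((Mfd.pi M).carrier → 𝕜) → 𝕜}
    (hadd : ∀ f g, (Mfd.pi M).SmoothAt f y → (Mfd.pi M).SmoothAt g y → D (f + g) = D f + D g)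
    (hzero : ∀ f, (Mfd.pi M).SmoothAt f y → (Mfd.pi M).d f y = 0 → D f = 0)
    (hpull : ∀ i f, (M i).SmoothAt f (y i) → D (pull M i f) = 0)
    {f : (Mfd.pi M).carrier → 𝕜} (hf : (Mfd.pi M).SmoothAt f y) : D f = 0 := by
  classical
  obtain ⟨ℓ, hℓ⟩ := exists_coord_d_eq ((Mfd.pi M).d f y)
  have hs : ∀ s : Finset (Fin n), D (fun z => ∑ i ∈ s, pull M i ((M i).coord (y i)
      (ℓ ∘L ContinuousLinearMap.single 𝕜 (fun i => (M i).E) i)) z) = 0 := by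
    intro s
    induction s using Finset.induction_on with
    | empty =>
      simp only [Finset.sum_empty]
      exact hzero _ (smoothAt_const 0) (d_const 0)
    | insert i s hi ih =>
      simp only [Finset.sum_insert hi]
      refine (hadd _ _ (SmoothAt.pull (smoothAt_coord _))
        (SmoothAt.sum s fun j _ => SmoothAt.pull (smoothAt_coord _))).trans ?_
      rw [ih, hpull i _ (smoothAt_coord _), add_zero]
  have hc := hs Finset.univ
  rw [← coord_pi] at hc
  -- Split `f` as a coordinate function with the same differential at `y` plus a remainder whose
  -- differential vanishes there.
  have h1 := hadd (f - (Mfd.pi M).coord y ℓ) _ (hf.sub (smoothAt_coord ℓ)) (smoothAt_coord ℓ)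
  rw [sub_add_cancel, hc, add_zero, hzero _ (hf.sub (smoothAt_coord ℓ))] at h1
  · exact h1
  · rw [d_sub hf (smoothAt_coord ℓ), hℓ, sub_self]

end Mfd

end Products

/-! ### Products of quasi-Poisson spaces -/

section ProductSpaces

open Mfd PreSpace

variable {𝕜 : Type w} [RCLike 𝕜] {L : Type v} [LieRing L] [LieAlgebra 𝕜 L] {n : ℕ}
  {Y : Fin n → PreSpace.{w, v, u} 𝕜 L} {y : (PreSpace.prod Y).M.carrier}

namespace PreSpace

/-- The pull-back of a function on a factor to the product. -/
abbrev pull (Y : Fin n → PreSpace.{w, v, u} 𝕜 L) (i : Fin n) (f : (Y i).M.carrier → 𝕜) :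
    (PreSpace.prod Y).M.carrier → 𝕜 := Mfd.pull (fun j => (Y j).M) i f

theorem smoothAt_pull {i : Fin n} {f : (Y i).M.carrier → 𝕜} (hf : (Y i).M.SmoothAt f (y i)) :
    (PreSpace.prod Y).M.SmoothAt (pull Y i f) y := SmoothAt.pull hf

theorem prod_induction {D : ((PreSpace.prod Y).M.carrier → 𝕜) → 𝕜}
    (hadd : ∀ f g, (PreSpace.prod Y).M.SmoothAt f y → (PreSpace.prod Y).M.SmoothAt g y →
      D (f + g) = D f + D g)
    (hzero : ∀ f, (PreSpace.prod Y).M.SmoothAt f y → (PreSpace.prod Y).M.d f y = 0 → D f = 0)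
    (hpull : ∀ i f, (Y i).M.SmoothAt f (y i) → D (pull Y i f) = 0)
    {f : (PreSpace.prod Y).M.carrier → 𝕜} (hf : (PreSpace.prod Y).M.SmoothAt f y) : D f = 0 :=
  pi_induction (M := fun j => (Y j).M) hadd hzero hpull hf

theorem eventually_deriv_pull (x : Fin n → L) {i : Fin n} {f : (Y i).M.carrier → 𝕜}
    (hf : (Y i).M.SmoothAt f (y i)) :
    (PreSpace.prod Y).M.deriv ((PreSpace.prod Y).act x) (pull Y i f) =ᶠ[𝓝 y]
      pull Y i ((Y i).M.deriv ((Y i).act (x i)) f) := by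
  filter_upwards [eventually_d_pull (M := fun j => (Y j).M) hf] with z hz
  exact congrArg (fun A : (∀ i, (Y i).M.E) →ₗ[𝕜] 𝕜 => A ((PreSpace.prod Y).act x z)) hz

theorem dAct_pull {i : Fin n} {f : (Y i).M.carrier → 𝕜}
    (hf : (Y i).M.SmoothAt f (y i)) :
    (PreSpace.prod Y).dAct (pull Y i f) y =
      (Y i).dAct f (y i) ∘ₗ LinearMap.proj (R := 𝕜) (φ := fun _ : Fin n => L) i :=
  LinearMap.ext fun x => (eventually_deriv_pull (y := y) x hf).eq_of_nhds

/-- The inclusion of the tangent space of a factor. -/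
abbrev tangentIncl (Y : Fin n → PreSpace.{w, v, u} 𝕜 L) (z : (PreSpace.prod Y).M.carrier)
    (k : Fin n) : (Y k).M.T (z k) →ₗ[𝕜] (PreSpace.prod Y).M.T z :=
  LinearMap.single 𝕜 (fun j => (Y j).M.E) k

theorem eval_prod {F G : (PreSpace.prod Y).M.carrier → 𝕜} (z : (PreSpace.prod Y).M.carrier) :
    (PreSpace.prod Y).M.eval (PreSpace.prod Y).tensor F G z =
      ∑ k, pair₂ ((Y k).tensor (z k)) ((PreSpace.prod Y).M.d F z ∘ₗ tangentIncl Y z k)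
        ((PreSpace.prod Y).M.d G z ∘ₗ tangentIncl Y z k) := by
  have h : (PreSpace.prod Y).tensor z = ∑ k, TensorProduct.map (tangentIncl Y z k)
    (tangentIncl Y z k) ((Y k).tensor (z k)) := rfl
  rw [Mfd.eval, h, pair₂_sum]
  exact Finset.sum_congr rfl fun k _ => pair₂_map _ _ _ _

theorem eventually_d_pull_comp {i : Fin n} {f : (Y i).M.carrier → 𝕜}
    (hf : (Y i).M.SmoothAt f (y i)) :
    ∀ᶠ z in 𝓝 y, (PreSpace.prod Y).M.d (pull Y i f) z ∘ₗ tangentIncl Y z i = (Y i).M.d f (z i) ∧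
      ∀ k, k ≠ i → (PreSpace.prod Y).M.d (pull Y i f) z ∘ₗ tangentIncl Y z k = 0 := by
  filter_upwards [eventually_d_pull (M := fun j => (Y j).M) hf] with z hz
  have h : ∀ k (v : (Y k).M.E), (PreSpace.prod Y).M.d (pull Y i f) z (tangentIncl Y z k v) =
      (Y i).M.d f (z i) (Pi.single (M := fun j => (Y j).M.E) k v i) := fun k v =>
    congrArg (fun A : (∀ i, (Y i).M.E) →ₗ[𝕜] 𝕜 => A (tangentIncl Y z k v)) hz
  refine ⟨LinearMap.ext fun v => ?_, fun k hk => LinearMap.ext fun v => ?_⟩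
  · exact (h i v).trans (congrArg _ (Pi.single_eq_same (M := fun j => (Y j).M.E) i v))
  · exact (h k v).trans ((congrArg _ (Pi.single_eq_of_ne (M := fun j => (Y j).M.E) hk.symm
      v)).trans (map_zero _))

theorem pair₂_zero_left {V : Type*} [AddCommGroup V] [Module 𝕜 V] (t : V ⊗[𝕜] V)
    (β : V →ₗ[𝕜] 𝕜) : pair₂ t 0 β = 0 := by rw [← pairForm_apply]; simp

theorem pair₂_zero_right {V : Type*} [AddCommGroup V] [Module 𝕜 V] (t : V ⊗[𝕜] V)
    (β : V →ₗ[𝕜] 𝕜) : pair₂ t β 0 = 0 := by rw [← pairForm_apply]; simp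

theorem eventually_eval_pull_same {i : Fin n} {f g : (Y i).M.carrier → 𝕜}
    (hf : (Y i).M.SmoothAt f (y i)) (hg : (Y i).M.SmoothAt g (y i)) :
    (PreSpace.prod Y).M.eval (PreSpace.prod Y).tensor (pull Y i f) (pull Y i g) =ᶠ[𝓝 y]
      pull Y i ((Y i).M.eval (Y i).tensor f g) := by
  filter_upwards [eventually_d_pull_comp hf, eventually_d_pull_comp hg] with z hz hz'
  rw [eval_prod, Finset.sum_eq_single i]
  · rw [hz.1, hz'.1]; rfl
  · intro k _ hk
    rw [hz.2 k hk, pair₂_zero_left]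
  · simp

theorem eventually_eval_pull_ne {i j : Fin n} (hij : i ≠ j) {f : (Y i).M.carrier → 𝕜}
    {g : (Y j).M.carrier → 𝕜}
    (hf : (Y i).M.SmoothAt f (y i)) (hg : (Y j).M.SmoothAt g (y j)) :
    (PreSpace.prod Y).M.eval (PreSpace.prod Y).tensor (pull Y i f) (pull Y j g) =ᶠ[𝓝 y] 0 := by
  filter_upwards [eventually_d_pull_comp hf, eventually_d_pull_comp hg] with z hz hz'
  rw [eval_prod]
  refine Finset.sum_eq_zero fun k _ => ?_
  by_cases hk : k = i
  · rw [hz'.2 k (hk ▸ hij), pair₂_zero_right]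
  · rw [hz.2 k hk, pair₂_zero_left]

theorem isLeftAction_prod (hY : ∀ i, (Y i).IsLeftAction) : (PreSpace.prod Y).IsLeftAction := by
  have hX : ∀ x y, (PreSpace.prod Y).M.VSmoothAt ((PreSpace.prod Y).act x) y := by
    intro x y
    refine vSmoothAt_of_coord fun k => ?_
    have hs : ∀ i ∈ Finset.univ, (PreSpace.prod Y).M.SmoothAt (pull Y i (((Y i).M).coord (y i)
        ((PreSpace.prod Y).M.cov k ∘L
          ContinuousLinearMap.single 𝕜 (fun i => (Y i).M.E) i))) y :=
      fun i _ => smoothAt_pull (smoothAt_coord _)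
    refine (SmoothAt.sum Finset.univ fun i _ => (smoothAt_pull (y := y) (hY i |>.vSmoothAt (x i)
      (y i) _ (smoothAt_coord ((PreSpace.prod Y).M.cov k ∘L
          ContinuousLinearMap.single 𝕜 (fun i => (Y i).M.E) i))))).congr ?_
    filter_upwards [eventually_d_sum Finset.univ hs, eventually_all.2 fun i =>
      eventually_deriv_pull (y := y) x (smoothAt_coord (M := (Y i).M) ((PreSpace.prod Y).M.cov k ∘L
          ContinuousLinearMap.single 𝕜 (fun i => (Y i).M.E) i))] with z hz hz'
    have e : (PreSpace.prod Y).M.coord y ((PreSpace.prod Y).M.cov k) = _ :=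
      coord_pi (M := fun j => (Y j).M) (y := y) ((PreSpace.prod Y).M.cov k)
    rw [Mfd.deriv, e]
    refine (congrArg (fun A => A ((PreSpace.prod Y).act x z)) hz).trans ?_
    rw [LinearMap.sum_apply]
    exact Finset.sum_congr rfl fun i _ => hz' i
  refine ⟨fun x => isSmoothVField_iff.2 (hX x), fun x x' => ?_⟩
  funext y
  -- Both sides are tangent vectors, so they may be compared on pull-backs, where each commutator is
  -- computed inside one factor.
  refine eq_of_d_eq fun f hf => ?_
  rw [← sub_eq_zero]
  refine prod_induction (Y := Y) (y := y) (D := fun f => (PreSpace.prod Y).M.d f y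
    ((PreSpace.prod Y).act ⁅x, x'⁆ y) - (PreSpace.prod Y).M.d f y ((-VectorField.mlieBracket
      𝓘(𝕜, (PreSpace.prod Y).M.E) ((PreSpace.prod Y).act x) ((PreSpace.prod Y).act x')) y))
    ?_ ?_ ?_ hf
  · intro f g hf hg
    rw [d_add (M := (PreSpace.prod Y).M) hf hg, LinearMap.add_apply, LinearMap.add_apply]
    ring
  · intro f hf h0
    rw [h0]; simp
  · intro i f hf
    have h1 : (PreSpace.prod Y).M.d (pull Y i f) y ((PreSpace.prod Y).act ⁅x, x'⁆ y) = _ :=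
      (eventually_deriv_pull (y := y) ⁅x, x'⁆ hf).eq_of_nhds
    have h2 := d_mlieBracket (hX x y) (hX x' y) (smoothAt_pull (Y := Y) hf)
    rw [deriv_congr (eventually_deriv_pull x' hf), deriv_congr (eventually_deriv_pull x hf),
      (eventually_deriv_pull x ((hY i).vSmoothAt (x' i) _ f hf)).eq_of_nhds,
      (eventually_deriv_pull x' ((hY i).vSmoothAt (x i) _ f hf)).eq_of_nhds] at h2
    have h3 := (hY i).deriv_comm (x i) (x' i) hf
    change (PreSpace.prod Y).M.d (pull Y i f) y _ - (PreSpace.prod Y).M.d (pull Y i f) y _ = _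
    rw [h1, Pi.neg_apply, map_neg, h2]
    change (Y i).M.deriv ((Y i).act ⁅x i, x' i⁆) f (y i) -
      -((Y i).M.deriv _ _ (y i) - (Y i).M.deriv _ _ (y i)) = 0
    rw [h3]; ring

theorem isBivector_prod (hY : ∀ i, (Y i).M.IsBivector (Y i).tensor) :
    (PreSpace.prod Y).M.IsBivector (PreSpace.prod Y).tensor := by
  refine isBivector_of_coord (fun z => ?_) fun y k l => ?_
  · have h : ∀ z, (PreSpace.prod Y).tensor z = ∑ k, TensorProduct.map (tangentIncl Y z k)
      (tangentIncl Y z k) ((Y k).tensor (z k)) := fun z => rfl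
    rw [h, flip, map_sum, ← Finset.sum_neg_distrib]
    refine Finset.sum_congr rfl fun k _ => (flip_map _ _ _).trans ?_
    rw [(hY k).1, map_neg]
  · let F (k : Fin _) (i : Fin n) : (Y i).M.carrier → 𝕜 := (Y i).M.coord (y i)
      ((PreSpace.prod Y).M.cov k ∘L ContinuousLinearMap.single 𝕜 (fun i => (Y i).M.E) i)
    have hF : ∀ k i, (Y i).M.SmoothAt (F k i) (y i) := fun k i => smoothAt_coord _
    have e : ∀ k, (PreSpace.prod Y).M.coord y ((PreSpace.prod Y).M.cov k) =
        fun z => ∑ i, pull Y i (F k i) z := fun k =>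
      coord_pi (M := fun j => (Y j).M) (y := y) ((PreSpace.prod Y).M.cov k)
    have hd : ∀ k, ∀ᶠ z in 𝓝 y, (PreSpace.prod Y).M.d (fun z => ∑ i, pull Y i (F k i) z) z =
        ∑ i, (PreSpace.prod Y).M.d (pull Y i (F k i)) z := fun k =>
      eventually_d_sum Finset.univ fun i _ => smoothAt_pull (hF k i)
    have hs : ∀ i j, (PreSpace.prod Y).M.SmoothAt ((PreSpace.prod Y).M.eval
        (PreSpace.prod Y).tensor (pull Y i (F k i)) (pull Y j (F l j))) y := by
      intro i j
      by_cases hij : i = j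
      · subst hij
        exact (smoothAt_pull ((hY i).2 _ _ _ (hF k i) (hF l i))).congr
          (eventually_eval_pull_same (hF k i) (hF l i))
      · exact (smoothAt_const 0).congr (eventually_eval_pull_ne hij (hF k i) (hF l j))
    refine (SmoothAt.sum Finset.univ fun i _ => SmoothAt.sum Finset.univ fun j _ =>
      hs i j).congr ?_
    filter_upwards [hd k, hd l] with z hz hz'
    rw [e, e, eval_eq_pairForm, hz, hz']
    simp only [map_sum, LinearMap.sum_apply]
    exact Finset.sum_comm

/-- By tensoriality both arguments may be taken to be pull-backs. From one factor this is the
invariance there; from two different factors every term vanishes. -/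
theorem lieD_prod (hY : ∀ i, (Y i).IsLeftAction) (hB : ∀ i, (Y i).M.IsBivector (Y i).tensor)
    (hinv : ∀ i (x : L) (f g : (Y i).M.carrier → 𝕜), (Y i).M.SmoothAt f (y i) →
      (Y i).M.SmoothAt g (y i) → (Y i).M.lieD ((Y i).act x) (Y i).tensor f g (y i) = 0)
    (x : Fin n → L) {f g : (PreSpace.prod Y).M.carrier → 𝕜}
    (hf : (PreSpace.prod Y).M.SmoothAt f y) (hg : (PreSpace.prod Y).M.SmoothAt g y) :
    (PreSpace.prod Y).M.lieD ((PreSpace.prod Y).act x) (PreSpace.prod Y).tensor f g y = 0 := by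
  have hX := (isLeftAction_prod hY).vSmoothAt x y
  have hA := isBivector_prod hB
  have hT := hA.tSmoothAt y
  refine prod_induction (Y := Y) (y := y) (D := fun f => (PreSpace.prod Y).M.lieD
    ((PreSpace.prod Y).act x) (PreSpace.prod Y).tensor f g y)
    (fun f f' hf hf' => lieD_add_left hX hT hf hf' hg)
    (fun f hf h0 => lieD_eq_zero hX hT hf hg h0) (fun i f hf => ?_) hf
  have hfp := smoothAt_pull (y := y) hf
  -- Skewness moves the second argument to the first place, where additivity and tensoriality are
  -- available.
  rw [← neg_eq_zero]
  refine (congrFun (lieD_swap (M := (PreSpace.prod Y).M) (X := (PreSpace.prod Y).act x) hA.1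
    (f := g)
    (g := pull Y i f)) y).symm.trans ?_
  refine prod_induction (Y := Y) (y := y) (D := fun g => (PreSpace.prod Y).M.lieD
    ((PreSpace.prod Y).act x) (PreSpace.prod Y).tensor g (pull Y i f) y)
    (fun f f' hf hf' => lieD_add_left hX hT hf hf' hfp)
    (fun f hf h0 => lieD_eq_zero hX hT hf hfp h0) (fun j g hg => ?_) hg
  have hxf := (hY i).vSmoothAt (x i) (y i) f hf
  have hxg := (hY j).vSmoothAt (x j) (y j) g hg
  rw [Mfd.lieD, Pi.sub_apply, Pi.sub_apply, eval_congr_left (eventually_deriv_pull x hg),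
    eval_congr_right (eventually_deriv_pull x hf)]
  by_cases hij : j = i
  · subst hij
    rw [deriv_congr (eventually_eval_pull_same hg hf),
      (eventually_deriv_pull x ((hB j).2 _ _ _ hg hf)).eq_of_nhds,
      (eventually_eval_pull_same hxg hf).eq_of_nhds, (eventually_eval_pull_same hg hxf).eq_of_nhds]
    exact hinv j (x j) g f hg hf
  · rw [deriv_congr (eventually_eval_pull_ne hij hg hf),
      (eventually_eval_pull_ne hij hxg hf).eq_of_nhds,
      (eventually_eval_pull_ne hij hg hxf).eq_of_nhds]
    simp [Mfd.deriv, d_zero]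

theorem eval_eval_pull_ne (hB : ∀ i, (Y i).M.IsBivector (Y i).tensor) {i j k : Fin n}
    (hijk : ¬(i = j ∧ j = k)) {f : (Y i).M.carrier → 𝕜} {g : (Y j).M.carrier → 𝕜}
    {h : (Y k).M.carrier → 𝕜} (hf : (Y i).M.SmoothAt f (y i)) (hg : (Y j).M.SmoothAt g (y j))
    (hh : (Y k).M.SmoothAt h (y k)) :
    (PreSpace.prod Y).M.eval (PreSpace.prod Y).tensor (pull Y i f)
      ((PreSpace.prod Y).M.eval (PreSpace.prod Y).tensor (pull Y j g) (pull Y k h)) y = 0 := by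
  by_cases hjk : j = k
  · subst hjk
    rw [eval_congr_right (eventually_eval_pull_same hg hh),
      (eventually_eval_pull_ne (fun e => hijk ⟨e, rfl⟩) hf ((hB j).2 _ _ _ hg hh)).eq_of_nhds]
    rfl
  · rw [eval_congr_right (eventually_eval_pull_ne hjk hg hh), eval_eq_zero_right d_zero]

theorem eval_eval_pull_same (hB : ∀ i, (Y i).M.IsBivector (Y i).tensor) {i : Fin n}
    {f g h : (Y i).M.carrier → 𝕜} (hf : (Y i).M.SmoothAt f (y i))
    (hg : (Y i).M.SmoothAt g (y i)) (hh : (Y i).M.SmoothAt h (y i)) :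
    (PreSpace.prod Y).M.eval (PreSpace.prod Y).tensor (pull Y i f)
      ((PreSpace.prod Y).M.eval (PreSpace.prod Y).tensor (pull Y i g) (pull Y i h)) y =
    (Y i).M.eval (Y i).tensor f ((Y i).M.eval (Y i).tensor g h) (y i) := by
  rw [eval_congr_right (eventually_eval_pull_same hg hh),
    (eventually_eval_pull_same hf ((hB i).2 _ _ _ hg hh)).eq_of_nhds]
  rfl

theorem pair₃_add_first {V : Type*} [AddCommGroup V] [Module 𝕜 V] (t : V ⊗[𝕜] (V ⊗[𝕜] V))
    (α α' β γ : V →ₗ[𝕜] 𝕜) : pair₃ t (α + α') β γ = pair₃ t α β γ + pair₃ t α' β γ := by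
  simp [pair₃, TensorProduct.map_add_left]

theorem pair₃_add_second {V : Type*} [AddCommGroup V] [Module 𝕜 V] (t : V ⊗[𝕜] (V ⊗[𝕜] V))
    (α β β' γ : V →ₗ[𝕜] 𝕜) : pair₃ t α (β + β') γ = pair₃ t α β γ + pair₃ t α β' γ := by
  simp [pair₃, TensorProduct.map_add_left, LinearMap.comp_add, TensorProduct.map_add_right]

theorem pair₃_add_third {V : Type*} [AddCommGroup V] [Module 𝕜 V] (t : V ⊗[𝕜] (V ⊗[𝕜] V))
    (α β γ γ' : V →ₗ[𝕜] 𝕜) : pair₃ t α β (γ + γ') = pair₃ t α β γ + pair₃ t α β γ' := by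
  simp [pair₃, LinearMap.comp_add, TensorProduct.map_add_right]

theorem pair₃_zero_first {V : Type*} [AddCommGroup V] [Module 𝕜 V] (t : V ⊗[𝕜] (V ⊗[𝕜] V))
    (β γ : V →ₗ[𝕜] 𝕜) : pair₃ t 0 β γ = 0 := by
  simpa using pair₃_add_first t 0 0 β γ

theorem pair₃_zero_second {V : Type*} [AddCommGroup V] [Module 𝕜 V] (t : V ⊗[𝕜] (V ⊗[𝕜] V))
    (β γ : V →ₗ[𝕜] 𝕜) : pair₃ t β 0 γ = 0 := by
  simpa using pair₃_add_second t β 0 0 γ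

theorem pair₃_zero_third {V : Type*} [AddCommGroup V] [Module 𝕜 V] (t : V ⊗[𝕜] (V ⊗[𝕜] V))
    (β γ : V →ₗ[𝕜] 𝕜) : pair₃ t β γ 0 = 0 := by
  simpa using pair₃_add_third t β γ 0 0

theorem proj_comp_incl_same (i : Fin n) :
    LinearMap.proj (R := 𝕜) (φ := fun _ : Fin n => L) i ∘ₗ incl 𝕜 L i = LinearMap.id := by
  ext x; simp [incl]

theorem proj_comp_incl_ne {i j : Fin n} (hij : i ≠ j) :
    LinearMap.proj (R := 𝕜) (φ := fun _ : Fin n => L) i ∘ₗ incl 𝕜 L j = 0 := by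
  ext x; simp [incl, hij]

theorem pair₃_copies₃_same (φ : L ⊗[𝕜] (L ⊗[𝕜] L)) (i : Fin n) (α β γ : L →ₗ[𝕜] 𝕜) :
    pair₃ (copies₃ n φ) (α ∘ₗ LinearMap.proj i) (β ∘ₗ LinearMap.proj i) (γ ∘ₗ LinearMap.proj i) =
      pair₃ φ α β γ := by
  rw [copies₃, pair₃_sum, Finset.sum_eq_single i]
  · simp only [pair₃_map₃, LinearMap.comp_assoc, proj_comp_incl_same, LinearMap.comp_id]
  · intro k _ hk
    simp only [pair₃_map₃, LinearMap.comp_assoc, proj_comp_incl_ne hk.symm, LinearMap.comp_zero,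
      pair₃_zero_first]
  · simp

theorem pair₃_copies₃_ne (φ : L ⊗[𝕜] (L ⊗[𝕜] L)) {i j k : Fin n} (hijk : ¬(i = j ∧ j = k))
    (α β γ : L →ₗ[𝕜] 𝕜) :
    pair₃ (copies₃ n φ) (α ∘ₗ LinearMap.proj i) (β ∘ₗ LinearMap.proj j) (γ ∘ₗ LinearMap.proj k) =
      0 := by
  rw [copies₃, pair₃_sum]
  refine Finset.sum_eq_zero fun m _ => ?_
  simp only [pair₃_map₃, LinearMap.comp_assoc]
  by_cases hi : i = m
  · by_cases hj : j = m
    · have hk : k ≠ m := fun hk => hijk ⟨hi.trans hj.symm, hj.trans hk.symm⟩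
      simp only [proj_comp_incl_ne hk, LinearMap.comp_zero, pair₃_zero_third]
    · simp only [proj_comp_incl_ne hj, LinearMap.comp_zero, pair₃_zero_second]
  · simp only [proj_comp_incl_ne hi, LinearMap.comp_zero, pair₃_zero_first]

/-- Neither side has components mixing different factors: the product bivector pairs different
factors to zero, and `(φ, …, φ)` lives on the diagonal. -/
theorem schouten_prod_pull {φ : L ⊗[𝕜] (L ⊗[𝕜] L)} (hB : ∀ i, (Y i).M.IsBivector (Y i).tensor)
    (hφ : ∀ i (f g h : (Y i).M.carrier → 𝕜), (Y i).M.SmoothAt f (y i) →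
      (Y i).M.SmoothAt g (y i) → (Y i).M.SmoothAt h (y i) →
      (Y i).M.schouten (Y i).tensor (Y i).tensor f g h (y i) =
        pair₃ φ ((Y i).dAct f (y i)) ((Y i).dAct g (y i)) ((Y i).dAct h (y i)))
    {i j k : Fin n} {f : (Y i).M.carrier → 𝕜} {g : (Y j).M.carrier → 𝕜}
    {h : (Y k).M.carrier → 𝕜} (hf : (Y i).M.SmoothAt f (y i)) (hg : (Y j).M.SmoothAt g (y j))
    (hh : (Y k).M.SmoothAt h (y k)) :
    (PreSpace.prod Y).M.schouten (PreSpace.prod Y).tensor (PreSpace.prod Y).tensor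
      (pull Y i f) (pull Y j g) (pull Y k h) y =
      pair₃ (copies₃ n φ) ((PreSpace.prod Y).dAct (pull Y i f) y)
        ((PreSpace.prod Y).dAct (pull Y j g) y) ((PreSpace.prod Y).dAct (pull Y k h) y) := by
  rw [dAct_pull hf, dAct_pull hg, dAct_pull hh, Mfd.schouten]
  simp only [Pi.add_apply]
  by_cases hijk : i = j ∧ j = k
  · obtain ⟨rfl, rfl⟩ := hijk
    rw [pair₃_copies₃_same, ← hφ i f g h hf hg hh, eval_eval_pull_same hB hf hg hh,
      eval_eval_pull_same hB hg hh hf, eval_eval_pull_same hB hh hf hg, Mfd.schouten]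
    rfl
  · rw [pair₃_copies₃_ne φ hijk, eval_eval_pull_ne hB hijk hf hg hh,
      eval_eval_pull_ne hB (fun e => hijk ⟨(e.1.trans e.2).symm, e.1⟩) hg hh hf,
      eval_eval_pull_ne hB (fun e => hijk ⟨e.2, (e.1.trans e.2).symm⟩) hh hf hg]
    simp only [add_zero]

-- Both sides are additive in each argument and depend only on differentials at `y`, so the
-- arguments are replaced by pull-backs one at a time. Cyclic symmetry brings each of them to the
-- first place.
set_option maxHeartbeats 1000000 in
theorem schouten_prod {φ : L ⊗[𝕜] (L ⊗[𝕜] L)} (hB : ∀ i, (Y i).M.IsBivector (Y i).tensor)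
    (hφ : ∀ i (f g h : (Y i).M.carrier → 𝕜), (Y i).M.SmoothAt f (y i) →
      (Y i).M.SmoothAt g (y i) → (Y i).M.SmoothAt h (y i) →
      (Y i).M.schouten (Y i).tensor (Y i).tensor f g h (y i) =
        pair₃ φ ((Y i).dAct f (y i)) ((Y i).dAct g (y i)) ((Y i).dAct h (y i)))
    {f g h : (PreSpace.prod Y).M.carrier → 𝕜} (hf : (PreSpace.prod Y).M.SmoothAt f y)
    (hg : (PreSpace.prod Y).M.SmoothAt g y) (hh : (PreSpace.prod Y).M.SmoothAt h y) :
    (PreSpace.prod Y).M.schouten (PreSpace.prod Y).tensor (PreSpace.prod Y).tensor f g h y =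
      pair₃ (copies₃ n φ) ((PreSpace.prod Y).dAct f y) ((PreSpace.prod Y).dAct g y)
        ((PreSpace.prod Y).dAct h y) := by
  have hA := isBivector_prod hB
  have hT := hA.tSmoothAt y
  have dadd : ∀ {f f' : (PreSpace.prod Y).M.carrier → 𝕜}, (PreSpace.prod Y).M.SmoothAt f y →
      (PreSpace.prod Y).M.SmoothAt f' y → (PreSpace.prod Y).dAct (f + f') y =
        (PreSpace.prod Y).dAct f y + (PreSpace.prod Y).dAct f' y := fun hf hf' => by
    rw [dAct, d_add hf hf', LinearMap.add_comp]; rfl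
  have dzero : ∀ {f : (PreSpace.prod Y).M.carrier → 𝕜}, (PreSpace.prod Y).M.d f y = 0 →
      (PreSpace.prod Y).dAct f y = 0 := fun h0 => by
    rw [dAct, h0, LinearMap.zero_comp]
  rw [← sub_eq_zero]
  refine prod_induction (Y := Y) (y := y) (D := fun f =>
    (PreSpace.prod Y).M.schouten (PreSpace.prod Y).tensor (PreSpace.prod Y).tensor f g h y -
      pair₃ (copies₃ n φ) ((PreSpace.prod Y).dAct f y) ((PreSpace.prod Y).dAct g y)
        ((PreSpace.prod Y).dAct h y)) (fun f f' hf hf' => ?_) (fun f hf h0 => ?_)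
      (fun i f hf => ?_) hf
  · rw [schouten_add_left hT hf hf' hg hh, dadd hf hf', pair₃_add_first]; ring
  · rw [schouten_eq_zero hA hf hg hh h0, dzero h0, pair₃_zero_first, sub_zero]
  have hf' := smoothAt_pull (y := y) hf
  refine prod_induction (Y := Y) (y := y) (D := fun g =>
    (PreSpace.prod Y).M.schouten (PreSpace.prod Y).tensor (PreSpace.prod Y).tensor
      (pull Y i f) g h y -
      pair₃ (copies₃ n φ) ((PreSpace.prod Y).dAct (pull Y i f) y) ((PreSpace.prod Y).dAct g y)
        ((PreSpace.prod Y).dAct h y)) (fun g g' hg hg' => ?_) (fun g hg h0 => ?_)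
      (fun j g hg => ?_) hg
  · rw [schouten_rotate, schouten_add_left hT hg hg' hh hf', dadd hg hg', pair₃_add_second,
      schouten_rotate (f := pull Y i f), schouten_rotate (f := pull Y i f)]; ring
  · rw [schouten_rotate, schouten_eq_zero hA hg hh hf' h0, dzero h0, pair₃_zero_second, sub_zero]
  have hg' := smoothAt_pull (y := y) hg
  refine prod_induction (Y := Y) (y := y) (D := fun h =>
    (PreSpace.prod Y).M.schouten (PreSpace.prod Y).tensor (PreSpace.prod Y).tensor
      (pull Y i f) (pull Y j g) h y -
      pair₃ (copies₃ n φ) ((PreSpace.prod Y).dAct (pull Y i f) y)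
        ((PreSpace.prod Y).dAct (pull Y j g) y)
        ((PreSpace.prod Y).dAct h y)) (fun h h' hh hh' => ?_) (fun h hh h0 => ?_)
      (fun k h hh => ?_) hh
  · rw [← schouten_rotate, schouten_add_left hT hh hh' hf' hg', dadd hh hh', pair₃_add_third,
      schouten_rotate (f := h), schouten_rotate (f := h')]; ring
  · rw [← schouten_rotate, schouten_eq_zero hA hh hf' hg' h0, dzero h0, pair₃_zero_third, sub_zero]
  exact sub_eq_zero.2 (schouten_prod_pull hB hφ hf hg hh)

/-- On the quasi-Poisson side the plain product needs no mixing term. The Poisson fusion product is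
obtained from it by untwisting, not by a direct computation. -/
theorem IsQuasiPoissonSpace.prod {φ : L ⊗[𝕜] (L ⊗[𝕜] L)}
    (hY : ∀ i, (Y i).IsQuasiPoissonSpace φ) :
    (PreSpace.prod Y).IsQuasiPoissonSpace (copies₃ n φ) := by
  have hl := fun i => (hY i).isLeftAction
  have hB := fun i => (hY i).isBivector
  refine ⟨isLeftAction_prod hl, isBivector_prod hB, fun x y f g hf hg =>
    lieD_prod hl hB (fun i x => (hY i).invariant x (y i)) x hf hg, fun y f g h hf hg hh => ?_⟩
  rw [pair₃_map₃]
  refine schouten_prod hB (fun i f g h hf hg hh => ?_) hf hg hh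
  rw [(hY i).quasiPoisson _ f g h hf hg hh, pair₃_map₃]
  rfl

end PreSpace

end ProductSpaces

/-! ### Functors between the categories and their commutation -/

section Categories

variable {𝕜 : Type w} [RCLike 𝕜] {L : Type v} [LieRing L] [LieAlgebra 𝕜 L] {n : ℕ}

namespace PreSpace

theorem hom_heq {Y Y' Z Z' : PreSpace.{w, v, u} 𝕜 L} (hY : Y = Y') (hZ : Z = Z')
    (f : Y ⟶ Z) (g : Y' ⟶ Z') (h : Hom.toFun f ≍ Hom.toFun g) : f ≍ g := by
  subst hY hZ
  exact heq_of_eq (Hom.ext (eq_of_heq h))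

/-- A morphism is determined by its underlying map. All functors here are the identity on maps, so
strict equality of functors reduces to equality on objects. -/
theorem functor_ext {C : Type*} [Category C] {F G : C ⥤ PreSpace.{w, v, u} 𝕜 L}
    (hobj : ∀ X, F.obj X = G.obj X)
    (hmap : ∀ (X Y : C) (f : X ⟶ Y), Hom.toFun (F.map f) ≍ Hom.toFun (G.map f)) : F = G :=
  Functor.hext hobj fun X Y f => hom_heq (hobj X) (hobj Y) _ _ (hmap X Y f)

theorem obj_ext {M : Mfd.{w, u} 𝕜} {A B : M.TField} {act : L →ₗ[𝕜] M.VField} (h : A = B) :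
    PreSpace.mk M A act = PreSpace.mk M B act := by rw [h]

theorem twist_obj_obj (t t' : L ⊗[𝕜] L) (Y : PreSpace.{w, v, u} 𝕜 L) :
    (twist t').obj ((twist t).obj Y) = (twist (t + t')).obj Y := by
  refine obj_ext (act := Y.act) ?_
  rw [act₂_add, ← add_assoc]
  rfl

theorem twist_zero_obj (Y : PreSpace.{w, v, u} 𝕜 L) : (twist (0 : L ⊗[𝕜] L)).obj Y = Y := by
  refine obj_ext (act := Y.act) ?_
  rw [act₂_zero, add_zero]

theorem twist_restrict_obj {L' : Type v} [LieRing L'] [LieAlgebra 𝕜 L'] (φ : L' →ₗ[𝕜] L)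
    (t : L' ⊗[𝕜] L') (Y : PreSpace.{w, v, u} 𝕜 L) :
    (twist t).obj ((restrict φ).obj Y) =
      (restrict φ).obj ((twist (TensorProduct.map φ φ t)).obj Y) := by
  have h : ((restrict φ).obj Y).act₂ t = Y.act₂ (TensorProduct.map φ φ t) := by
    refine funext fun (y : Y.M.carrier) => ?_
    exact (LinearMap.congr_fun (TensorProduct.map_comp (Y.actAt y) (Y.actAt y) φ φ) t)
  exact obj_ext (act := Y.act ∘ₗ φ) (congrArg (Y.tensor + ·) h)

/-- The `j`-th summand of `L^n` acts only through the tangent space of the `j`-th factor, so no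
cross terms arise. -/
theorem prod_twist (t : L ⊗[𝕜] L) (Y : Fin n → PreSpace.{w, v, u} 𝕜 L) :
    PreSpace.prod (fun j => (twist t).obj (Y j)) = (twist (copies₂ n t)).obj (PreSpace.prod Y) := by
  refine obj_ext (act := (PreSpace.prod Y).act) ?_
  refine funext fun (y : (PreSpace.prod Y).M.carrier) => ?_
  have h : ∀ j, (PreSpace.prod Y).actAt y ∘ₗ incl 𝕜 L j =
      tangentIncl Y y j ∘ₗ (Y j).actAt (y j) := by
    intro j
    refine LinearMap.ext fun x => funext fun k => ?_
    change (Y k).act (Pi.single (M := fun _ => L) j x k) (y k) =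
      Pi.single (M := fun k => (Y k).M.E) j ((Y j).act x (y j)) k
    by_cases hk : k = j
    · subst hk; rw [Pi.single_eq_same]; exact (Pi.single_eq_same (M := fun k => (Y k).M.E) _ _).symm
    · rw [Pi.single_eq_of_ne hk, map_zero]
      exact (Pi.single_eq_of_ne (M := fun k => (Y k).M.E) hk _).symm
  have h2 : (PreSpace.prod Y).act₂ (copies₂ n t) y = ∑ j, TensorProduct.map (tangentIncl Y y j)
      (tangentIncl Y y j) ((Y j).act₂ t (y j)) := by
    rw [act₂, copies₂, map_sum]
    refine Finset.sum_congr rfl fun j _ => ?_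
    rw [act₂, ← LinearMap.comp_apply, ← TensorProduct.map_comp, h, TensorProduct.map_comp]
    rfl
  rw [Pi.add_apply, h2]
  change ∑ j, TensorProduct.map (tangentIncl Y y j) (tangentIncl Y y j)
    ((Y j).tensor (y j) + (Y j).act₂ t (y j)) = ∑ j, TensorProduct.map (tangentIncl Y y j)
      (tangentIncl Y y j) ((Y j).tensor (y j)) + _
  rw [← Finset.sum_add_distrib]
  exact Finset.sum_congr rfl fun j _ => map_add _ _ _

end PreSpace

open PreSpace

theorem fullSubcategory_functor_ext {C D : Type*} [Category C] [Category D]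
    {P : ObjectProperty D} {F G : C ⥤ P.FullSubcategory} (h : F ⋙ P.ι = G ⋙ P.ι) : F = G := by
  have key : ∀ {K K' : C ⥤ D} (hK : ∀ X, P (K.obj X)) (hK' : ∀ X, P (K'.obj X)), K = K' →
      P.lift K hK = P.lift K' hK' := by
    rintro K _ hK hK' rfl; rfl
  exact key (fun X => (F.obj X).property) (fun X => (G.obj X).property) h

/-- `(Y, π, λ) ↦ (Y, π + λ(Λ), λ)` is an equivalence from Poisson spaces to quasi-Poisson spaces. -/
theorem IsQuasitriangular.exists_equivalence {r t : L ⊗[𝕜] L} (hr : IsQuasitriangular r)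
    (ht : skewPart r = t) {φ : L ⊗[𝕜] (L ⊗[𝕜] L)} (hφ : phi (symPart r) = φ) :
    ∃ T : PoissonCat.{w, v, u} (coBracket r) ≌ QuasiPoissonCat.{w, v, u} φ,
      T.functor ⋙ QuasiPoissonCat.incl _ = PoissonCat.incl _ ⋙ PreSpace.twist t ∧
      T.inverse ⋙ PoissonCat.incl _ = QuasiPoissonCat.incl _ ⋙ PreSpace.twist (-t) := by
  -- Keeping `t` and `φ` as variables lets the same statement serve for `r^{(n)}`, whose skew part
  -- and trivector are wanted in explicit form.
  subst ht hφ
  let F : PoissonCat.{w, v, u} (coBracket r) ⥤ QuasiPoissonCat.{w, v, u} (phi (symPart r)) :=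
    ObjectProperty.lift _ (PoissonCat.incl _ ⋙ PreSpace.twist (skewPart r))
      fun X => X.property.twist hr
  let G : QuasiPoissonCat.{w, v, u} (phi (symPart r)) ⥤ PoissonCat.{w, v, u} (coBracket r) :=
    ObjectProperty.lift _ (QuasiPoissonCat.incl _ ⋙ PreSpace.twist (-skewPart r))
      fun X => X.property.twist hr
  -- The two functors are strictly inverse to each other, so unit and counit are transports along
  -- equalities.
  have h1 : 𝟭 _ = F ⋙ G := fullSubcategory_functor_ext <| functor_ext
    (fun X => by
      change X.obj = (PreSpace.twist _).obj ((PreSpace.twist _).obj X.obj)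
      rw [twist_obj_obj, add_neg_cancel, twist_zero_obj])
    fun X Y f => HEq.rfl
  have h2 : G ⋙ F = 𝟭 _ := fullSubcategory_functor_ext <| functor_ext
    (fun X => by
      change (PreSpace.twist _).obj ((PreSpace.twist _).obj X.obj) = X.obj
      rw [twist_obj_obj, neg_add_cancel, twist_zero_obj])
    fun X Y f => HEq.rfl
  exact ⟨CategoryTheory.Equivalence.mk F G (eqToIso h1) (eqToIso h2), rfl, rfl⟩

theorem restrict_diag_twist_obj (r : L ⊗[𝕜] L) (Z : PreSpace.{w, v, u} 𝕜 (Fin n → L)) :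
    (PreSpace.twist (skewPart r)).obj ((PreSpace.restrict (diag 𝕜 L n)).obj Z) =
      (PreSpace.restrict (diag 𝕜 L n)).obj ((PreSpace.twist (mix n (symPart r))).obj
        ((PreSpace.twist (copies₂ n (skewPart r) - mix n r)).obj Z)) := by
  rw [twist_restrict_obj, twist_obj_obj, map_diag_skewPart_eq]

theorem restrict_diag_twist_neg_obj (r : L ⊗[𝕜] L) (Z : PreSpace.{w, v, u} 𝕜 (Fin n → L)) :
    (PreSpace.twist (skewPart r)).obj ((PreSpace.restrict (diag 𝕜 L n)).obj
      ((PreSpace.twist (-(copies₂ n (skewPart r) - mix n r))).obj Z)) =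
      (PreSpace.restrict (diag 𝕜 L n)).obj ((PreSpace.twist (mix n (symPart r))).obj Z) := by
  rw [restrict_diag_twist_obj, twist_obj_obj, twist_obj_obj, ← add_assoc, neg_add_cancel, zero_add]

theorem restrict_diag_twist_inverse_obj (r : L ⊗[𝕜] L) (Z : PreSpace.{w, v, u} 𝕜 (Fin n → L)) :
    (PreSpace.restrict (diag 𝕜 L n)).obj
      ((PreSpace.twist (-(copies₂ n (skewPart r) - mix n r))).obj Z) =
      (PreSpace.twist (-skewPart r)).obj ((PreSpace.restrict (diag 𝕜 L n)).obj
        ((PreSpace.twist (mix n (symPart r))).obj Z)) := by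
  rw [← restrict_diag_twist_neg_obj, twist_obj_obj, add_neg_cancel, twist_zero_obj]

theorem IsQuasitriangular.isPoissonSpace_restrict {r : L ⊗[𝕜] L} (hr : IsQuasitriangular r)
    {Y : PreSpace.{w, v, u} 𝕜 (Fin n → L)}
    (hY : Y.IsPoissonSpace (coBracket (QuasiPoisson.rPow n r))) :
    ((PreSpace.restrict (diag 𝕜 L n)).obj Y).IsPoissonSpace (coBracket r) :=
  hY.restrict _ (fun _ _ => rfl) (coBracket_rPow_diag hr)

/-- The fusion equals untwisting by `r^{(n)}`, restricting to the diagonal and twisting by `r`; each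
of these preserves the structure. -/
theorem IsQuasitriangular.isQuasiPoissonSpace_fusion {r : L ⊗[𝕜] L} (hr : IsQuasitriangular r)
    {Y : PreSpace.{w, v, u} 𝕜 (Fin n → L)}
    (hY : Y.IsQuasiPoissonSpace (copies₃ n (phi (symPart r)))) :
    ((PreSpace.restrict (diag 𝕜 L n)).obj ((PreSpace.twist (mix n (symPart r))).obj
      Y)).IsQuasiPoissonSpace (phi (symPart r)) := by
  rw [← phi_symPart_rPow] at hY
  rw [← restrict_diag_twist_neg_obj, ← skewPart_rPow]
  exact (hr.isPoissonSpace_restrict (hY.twist (hr.rPow n))).twist hr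

/-- Twisting the factors contributes `(Λ, …, Λ)`, which the inverse twist on `L^n` removes, leaving
exactly `+Mixⁿ(r)`. -/
theorem fusion_eq (r : L ⊗[𝕜] L) (Y : Fin n → PreSpace.{w, v, u} 𝕜 L) :
    (PreSpace.restrict (diag 𝕜 L n)).obj
      ((PreSpace.twist (-(copies₂ n (skewPart r) - mix n r))).obj
        (PreSpace.prod fun j => (PreSpace.twist (skewPart r)).obj (Y j))) =
      PreSpace.fusion (mix n r) Y := by
  rw [prod_twist, twist_obj_obj, neg_sub, add_sub_cancel]
  rfl

end Categories

end

end QuasiPoisson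

/-! ### The main theorem -/

theorem mainTheorem9 {𝕜 : Type w} [RCLike 𝕜] {L : Type v} [LieRing L] [LieAlgebra 𝕜 L]
    [FiniteDimensional 𝕜 L] (r : L ⊗[𝕜] L) (hr : QuasiPoisson.IsQuasitriangular r)
    (n : ℕ) (hn : 2 ≤ n) :
    QuasiPoisson.IsQuasitriangular (QuasiPoisson.rPow n r) ∧
    ∃ (T : QuasiPoisson.PoissonCat.{w, v, u} (QuasiPoisson.coBracket r) ≌
          QuasiPoisson.QuasiPoissonCat.{w, v, u} (QuasiPoisson.phi (QuasiPoisson.symPart r)))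
      (Tn : QuasiPoisson.PoissonCat.{w, v, u}
            (QuasiPoisson.coBracket (QuasiPoisson.rPow n r)) ≌
          QuasiPoisson.QuasiPoissonCat.{w, v, u}
            (QuasiPoisson.copies₃ n (QuasiPoisson.phi (QuasiPoisson.symPart r))))
      (Res : QuasiPoisson.PoissonCat.{w, v, u}
            (QuasiPoisson.coBracket (QuasiPoisson.rPow n r)) ⥤
          QuasiPoisson.PoissonCat.{w, v, u} (QuasiPoisson.coBracket r))
      (Fus : QuasiPoisson.QuasiPoissonCat.{w, v, u}
            (QuasiPoisson.copies₃ n (QuasiPoisson.phi (QuasiPoisson.symPart r))) ⥤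
          QuasiPoisson.QuasiPoissonCat.{w, v, u}
            (QuasiPoisson.phi (QuasiPoisson.symPart r))),
      -- `T` is `(Y, π, λ) ↔ (Y, Q, λ)`, `Q = π + λ(Λ)`, the identity on morphisms
      T.functor ⋙ QuasiPoisson.QuasiPoissonCat.incl _ =
        QuasiPoisson.PoissonCat.incl _ ⋙
          QuasiPoisson.PreSpace.twist (QuasiPoisson.skewPart r) ∧
      T.inverse ⋙ QuasiPoisson.PoissonCat.incl _ =
        QuasiPoisson.QuasiPoissonCat.incl _ ⋙
          QuasiPoisson.PreSpace.twist (-QuasiPoisson.skewPart r) ∧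
      -- `Tn` is the same for `r^{(n)}`, with `Q = π + λ(Λ, …, Λ) - λ(Mixⁿ(r))`
      QuasiPoisson.skewPart (QuasiPoisson.rPow n r) =
        QuasiPoisson.copies₂ n (QuasiPoisson.skewPart r) - QuasiPoisson.mix n r ∧
      QuasiPoisson.phi (QuasiPoisson.symPart (QuasiPoisson.rPow n r)) =
        QuasiPoisson.copies₃ n (QuasiPoisson.phi (QuasiPoisson.symPart r)) ∧
      Tn.functor ⋙ QuasiPoisson.QuasiPoissonCat.incl _ =
        QuasiPoisson.PoissonCat.incl _ ⋙ QuasiPoisson.PreSpace.twist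
          (QuasiPoisson.copies₂ n (QuasiPoisson.skewPart r) - QuasiPoisson.mix n r) ∧
      Tn.inverse ⋙ QuasiPoisson.PoissonCat.incl _ =
        QuasiPoisson.QuasiPoissonCat.incl _ ⋙ QuasiPoisson.PreSpace.twist
          (-(QuasiPoisson.copies₂ n (QuasiPoisson.skewPart r) - QuasiPoisson.mix n r)) ∧
      -- `Res` is `(Y, π, λ) ↦ (Y, π, λ ∘ diag)`
      Res ⋙ QuasiPoisson.PoissonCat.incl _ =
        QuasiPoisson.PoissonCat.incl _ ⋙
          QuasiPoisson.PreSpace.restrict (QuasiPoisson.diag 𝕜 L n) ∧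
      -- `Fus` is `(Y, Q, λ) ↦ (Y, Q + λ(Mixⁿ(s)), λ ∘ diag)`
      Fus ⋙ QuasiPoisson.QuasiPoissonCat.incl _ =
        QuasiPoisson.QuasiPoissonCat.incl _ ⋙
          QuasiPoisson.PreSpace.twist (QuasiPoisson.mix n (QuasiPoisson.symPart r)) ⋙
          QuasiPoisson.PreSpace.restrict (QuasiPoisson.diag 𝕜 L n) ∧
      -- the diagram commutes, in both horizontal directions
      Res ⋙ T.functor = Tn.functor ⋙ Fus ∧
      Tn.inverse ⋙ Res = Fus ⋙ T.inverse ∧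
      -- fusion products correspond to each other
      ∀ Y : Fin n → QuasiPoisson.PoissonCat.{w, v, u} (QuasiPoisson.coBracket r),
        ∃ (P : QuasiPoisson.PoissonCat.{w, v, u} (QuasiPoisson.coBracket r))
          (F : QuasiPoisson.QuasiPoissonCat.{w, v, u}
            (QuasiPoisson.phi (QuasiPoisson.symPart r))),
          P.obj = QuasiPoisson.PreSpace.fusion (QuasiPoisson.mix n r) (fun j => (Y j).obj) ∧
          F.obj = QuasiPoisson.PreSpace.fusion (QuasiPoisson.mix n (QuasiPoisson.symPart r))
            (fun j => (T.functor.obj (Y j)).obj) ∧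
          T.functor.obj P = F := by
  have hrn := hr.rPow n
  obtain ⟨T, hT, hT'⟩ := hr.exists_equivalence rfl rfl
  obtain ⟨Tn, hTn, hTn'⟩ := hrn.exists_equivalence (QuasiPoisson.skewPart_rPow r)
    (QuasiPoisson.phi_symPart_rPow r n)
  let Res : QuasiPoisson.PoissonCat.{w, v, u}
      (QuasiPoisson.coBracket (QuasiPoisson.rPow n r)) ⥤
        QuasiPoisson.PoissonCat.{w, v, u} (QuasiPoisson.coBracket r) :=
    ObjectProperty.lift _ (QuasiPoisson.PoissonCat.incl _ ⋙
      QuasiPoisson.PreSpace.restrict (QuasiPoisson.diag 𝕜 L n))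
      fun X => hr.isPoissonSpace_restrict X.property
  let Fus : QuasiPoisson.QuasiPoissonCat.{w, v, u}
      (QuasiPoisson.copies₃ n (QuasiPoisson.phi (QuasiPoisson.symPart r))) ⥤
        QuasiPoisson.QuasiPoissonCat.{w, v, u} (QuasiPoisson.phi (QuasiPoisson.symPart r)) :=
    ObjectProperty.lift _ (QuasiPoisson.QuasiPoissonCat.incl _ ⋙
      QuasiPoisson.PreSpace.twist (QuasiPoisson.mix n (QuasiPoisson.symPart r)) ⋙
      QuasiPoisson.PreSpace.restrict (QuasiPoisson.diag 𝕜 L n))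
      fun X => hr.isQuasiPoissonSpace_fusion X.property
  refine ⟨hrn, T, Tn, Res, Fus, hT, hT', QuasiPoisson.skewPart_rPow r,
    QuasiPoisson.phi_symPart_rPow r n, hTn, hTn', rfl, rfl, ?_, ?_, fun Y => ?_⟩
  · apply QuasiPoisson.fullSubcategory_functor_ext
    change Res ⋙ T.functor ⋙ QuasiPoisson.QuasiPoissonCat.incl _ =
      (Tn.functor ⋙ QuasiPoisson.QuasiPoissonCat.incl _) ⋙
        QuasiPoisson.PreSpace.twist (QuasiPoisson.mix n (QuasiPoisson.symPart r)) ⋙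
        QuasiPoisson.PreSpace.restrict (QuasiPoisson.diag 𝕜 L n)
    rw [hT, hTn]
    exact QuasiPoisson.PreSpace.functor_ext
      (fun X => QuasiPoisson.restrict_diag_twist_obj r X.obj) fun X Y f => HEq.rfl
  · apply QuasiPoisson.fullSubcategory_functor_ext
    change (Tn.inverse ⋙ QuasiPoisson.PoissonCat.incl _) ⋙
        QuasiPoisson.PreSpace.restrict (QuasiPoisson.diag 𝕜 L n) =
      Fus ⋙ T.inverse ⋙ QuasiPoisson.PoissonCat.incl _
    rw [hT', hTn']
    exact QuasiPoisson.PreSpace.functor_ext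
      (fun X => QuasiPoisson.restrict_diag_twist_inverse_obj r X.obj) fun X Y f => HEq.rfl
  -- `Z` is the product of the `T(Y_j)`. The Poisson fusion product is `Res(T_n⁻¹ Z)`, the
  -- quasi-Poisson one is `Fus(Z)`, and `T` relates them by the commutative square.
  · let Z : QuasiPoisson.QuasiPoissonCat.{w, v, u}
        (QuasiPoisson.copies₃ n (QuasiPoisson.phi (QuasiPoisson.symPart r))) :=
      ⟨QuasiPoisson.PreSpace.prod fun j => (T.functor.obj (Y j)).obj,
        QuasiPoisson.PreSpace.IsQuasiPoissonSpace.prod fun j => (T.functor.obj (Y j)).property⟩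
    have hZ : Z.obj = QuasiPoisson.PreSpace.prod fun j =>
        (QuasiPoisson.PreSpace.twist (QuasiPoisson.skewPart r)).obj (Y j).obj :=
      congrArg QuasiPoisson.PreSpace.prod (funext fun j => Functor.congr_obj hT (Y j))
    have hP : (Res.obj (Tn.inverse.obj Z)).obj =
        (QuasiPoisson.PreSpace.restrict (QuasiPoisson.diag 𝕜 L n)).obj
          ((QuasiPoisson.PreSpace.twist (-(QuasiPoisson.copies₂ n (QuasiPoisson.skewPart r) -
            QuasiPoisson.mix n r))).obj Z.obj) :=
      congrArg (QuasiPoisson.PreSpace.restrict (QuasiPoisson.diag 𝕜 L n)).obj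
        (Functor.congr_obj hTn' Z)
    refine ⟨Res.obj (Tn.inverse.obj Z), Fus.obj Z, ?_, rfl, ?_⟩
    · rw [hP, hZ]
      exact QuasiPoisson.fusion_eq r _
    · apply ObjectProperty.FullSubcategory.ext
      refine (Functor.congr_obj hT _).trans ?_
      change (QuasiPoisson.PreSpace.twist _).obj (Res.obj (Tn.inverse.obj Z)).obj = _
      rw [hP]
      exact QuasiPoisson.restrict_diag_twist_neg_obj r _
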